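/- Let $0\le t_0<T$, and let $L^p(t_0,T)$ denote real-valued functions. Consider the planar control-affine system with scalar input $$\dot x(t)=N_t(x(t))+B_t\,u(t),\qquad x(t_0)=x^0\in\mathbb R^2,\qquad u\in L^\infty(t_0,T),$$ where $N:[t_0,T]\times\mathbb R^2\to\mathbb R^2$ and $B:[t_0,T]\to\mathbb R^2$ satisfy the following for some constants $\nu,\Lambda_1,\Lambda_2,\Lambda_3,b_0,b_1,b_2$: * $t\mapsto N_t(x)$ is in $L^\infty(t_0,T;\mathbb R^2)$ for every $x$, with $|N_t(0)|\le\nu$ for a.e. $t$; $x\mapsto N_t(x)$ is $C^2$ for every $t\in[t_0,T]$, with $\|DN_t(x)\|\le\Lambda_1$ and $\|D^2N_t(x)\|\le\Lambda_2$ for all $(t,x)$; and $\|\partial_tDN_t(x)\|\le\Lambda_3$, i.e. $t\mapsto DN_t(x)$ is $\Lambda_3$-Lipschitz on $[t_0,T]$ for every $x$; * $B$ is differentiable on $[t_0,T]$ with $|B_t|\le b_0$, $|\dot B_t|\le b_1$ for all $t$, and $|\ddot B_t|\le b_2$, i.e. $\dot B$ is $b_2$-Lipschitz. Let $\Phi_{s,t}$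 be the flow of $\dot x=N_t(x)$ and $x_u$ the absolutely continuous solution of the controlled system. For $x^1\in\mathbb R^2$, put $$F_T(u)=\int_{t_0}^T D\Phi_{t,T}(x_u(t))\,B_t\,u(t)\,dt-\big(x^1-\Phi_{t_0,T}(x^0)\big),\qquad u\in L^\infty(t_0,T).$$ Let $DF_T(u):L^2(t_0,T)\to\mathbb R^2$ be the continuous extension to $L^2(t_0,T)$ of the Fréchet derivative of $F_T$ at $u\in L^\infty(t_0,T)$, and let $\mathcal M_T(u)=DF_T(u)\,DF_T(u)^*\in\mathbb R^{2\times2}$ be the empirical Gramian (it does not depend on $x^1$). Assume that for some $\beta>0$ $$\big|\det\big(B_t,\ DN_t(x)B_t-\dot B_t\big)\big|\ge\beta\qquad\text{for all }t\in[t_0,T],\ x\in\mathbb R^2.$$ Then for all $x^0\in\mathbb R^2$ and $U>0$ there is $\alpha>0$, depending only on $\beta$, $|x^0|$, $U$ and on the data $t_0,T,\nu,\Lambda_1,\Lambda_2,\Lambda_3,b_0,b_1,b_2$, such that the derivative $DF_T(u)$ exists and $$\mathcal M_T(u)\succeq\alpha\,\mathrm{Id}\qquad\text{for all }u\in L^\infty(t_0,T)\text{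 with }\|u\|_\infty\le U .$$ -/

import Mathlib

open MeasureTheory Set
open scoped ENNReal

namespace PlanarControl

noncomputable section

/-- The state space `ℝ²` with the Euclidean norm. -/
abbrev Plane : Type := EuclideanSpace ℝ (Fin 2)

/-- Lebesgue measure on `(t₀, T)`. -/
abbrev timeMeasure (t₀ T : ℝ) : Measure ℝ := volume.restrict (Ioo t₀ T)

/-- The space `L^∞((t₀, T); ℝ)` of controls. -/
abbrev Control (t₀ T : ℝ) : Type := Lp ℝ ∞ (timeMeasure t₀ T)

/-- The Hilbert space `L²((t₀, T); ℝ)`. -/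
abbrev ControlL2 (t₀ T : ℝ) : Type := Lp ℝ 2 (timeMeasure t₀ T)

/-- `y` is an absolutely continuous (Carathéodory) solution of `y' = f(r, y)` on the interval
between `s` and `t` with `y(s) = x`, in integrated form. -/
structure IsSolution (f : ℝ → Plane → Plane) (s t : ℝ) (x : Plane) (y : ℝ → Plane) : Prop where
  continuousOn : ContinuousOn y (uIcc s t)
  integrable : IntervalIntegrable (fun r => f r (y r)) volume s t
  eq_integral : ∀ r ∈ uIcc s t, y r = x + ∫ q in s..r, f q (y q)

open Classical in
/-- The solution of `y' = f(r, y)`, `y(s) = x`, on the interval between `s` and `t`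
(the zero curve if there is none). -/
def solution (f : ℝ → Plane → Plane) (s t : ℝ) (x : Plane) : ℝ → Plane :=
  if h : ∃ y, IsSolution f s t x y then h.choose else fun _ => 0

/-- The flow `Φ_{s,t}` of the drift `N`. -/
def flow (N : ℝ → Plane → Plane) (s t : ℝ) (x : Plane) : Plane :=
  solution N s t x t

/-- The trajectory `x_u` of `x'(t) = N_t(x(t)) + B_t u(t)`, `x(t₀) = x⁰`, on `[t₀, T]`. -/
def trajectory (N : ℝ → Plane → Plane) (B : ℝ → Plane) (t₀ T : ℝ) (x0 : Plane)
    (u : ℝ → ℝ) : ℝ → Plane :=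
  solution (fun t x => N t x + u t • B t) t₀ T x0

/-- `L_{u,τ} v = ∫_{t₀}^T DΦ_{t,τ}(x_u(t)) B_t v(t) dt`. -/
def inputMap (N : ℝ → Plane → Plane) (B : ℝ → Plane) (t₀ T τ : ℝ) (x0 : Plane)
    (u v : ℝ → ℝ) : Plane :=
  ∫ t in t₀..T, v t • fderiv ℝ (flow N t τ) (trajectory N B t₀ T x0 u t) (B t)

/-- The feasible map `F_τ(u) = L_{u,τ} u - (Φ_{T,τ}(x¹) - Φ_{t₀,τ}(x⁰))` on `L^∞((t₀, T))`. -/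
def feasibleMap (N : ℝ → Plane → Plane) (B : ℝ → Plane) (t₀ T τ : ℝ) (x0 x1 : Plane)
    (u : Control t₀ T) : Plane :=
  inputMap N B t₀ T τ x0 u u - (flow N T τ x1 - flow N t₀ τ x0)

/-- `D : L² → ℝ²` is the differential of the map `F` at `u`: the map `F` is Fréchet
differentiable at `u` on `L^∞`, and `D` is the (unique, by density) continuous linear extension to
`L²` of its Fréchet derivative. -/
def IsDifferential {t₀ T : ℝ} (F : Control t₀ T → Plane) (u : Control t₀ T)
    (D : ControlL2 t₀ T →L[ℝ] Plane) : Prop :=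
  DifferentiableAt ℝ F u ∧
    ∀ (v : Control t₀ T) (w : ControlL2 t₀ T), w =ᵐ[timeMeasure t₀ T] v → D w = fderiv ℝ F u v

open Classical in
/-- The differential `DF(u) : L² → ℝ²` (zero if there is none). -/
def differential {t₀ T : ℝ} (F : Control t₀ T → Plane) (u : Control t₀ T) :
    ControlL2 t₀ T →L[ℝ] Plane :=
  if h : ∃ D, IsDifferential F u D then h.choose else 0

/-- The empirical Gramian `M_τ(u) = DF_τ(u) DF_τ(u)^*`, as an operator on `ℝ²`.  If the solution
or the differential did not exist, this would be the zero operator, which is not coercive. -/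
def empiricalGramian (N : ℝ → Plane → Plane) (B : ℝ → Plane) (t₀ T τ : ℝ) (x0 x1 : Plane)
    (u : Control t₀ T) : Plane →L[ℝ] Plane :=
  (differential (feasibleMap N B t₀ T τ x0 x1) u).comp
    (ContinuousLinearMap.adjoint (differential (feasibleMap N B t₀ T τ x0 x1) u))

/-- The standing assumptions on the drift, with the bounds that occur in them.
The last one says `∂_t DN ∈ L^∞` with `‖∂_t DN_t(x)‖ ≤ Λ₃`, that is, Lipschitz dependence of
`DN_t(x)` on `t`. -/
structure DriftAssumption (t₀ T ν Λ₁ Λ₂ Λ₃ : ℝ) (N : ℝ → Plane → Plane) : Prop where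
  memLp : ∀ x, MemLp (fun t => N t x) ∞ (timeMeasure t₀ T)
  bound_zero : ∀ᵐ t ∂(timeMeasure t₀ T), ‖N t 0‖ ≤ ν
  contDiff : ∀ t ∈ Icc t₀ T, ContDiff ℝ 2 (N t)
  bound_fderiv : ∀ t ∈ Icc t₀ T, ∀ x, ‖fderiv ℝ (N t) x‖ ≤ Λ₁
  bound_fderiv_two : ∀ t ∈ Icc t₀ T, ∀ x, ‖fderiv ℝ (fderiv ℝ (N t)) x‖ ≤ Λ₂
  lipschitz_fderiv : ∀ x, ∀ s ∈ Icc t₀ T, ∀ t ∈ Icc t₀ T,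
    ‖fderiv ℝ (N t) x - fderiv ℝ (N s) x‖ ≤ Λ₃ * |t - s|

/-- The time derivative of the input vector on `[t₀, T]` (one-sided at the endpoints). -/
def inputDeriv (B : ℝ → Plane) (t₀ T t : ℝ) : Plane := derivWithin B (Icc t₀ T) t

/-- The standing assumptions `B, B', B'' ∈ L^∞` on the input vector, with bounds: `B` is
differentiable on `[t₀, T]`, and `B'` is Lipschitz, which is the same as a bounded `B''`. -/
structure InputAssumption (t₀ T b₀ b₁ b₂ : ℝ) (B : ℝ → Plane) : Prop where
  differentiableOn : DifferentiableOn ℝ B (Icc t₀ T)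
  bound : ∀ t ∈ Icc t₀ T, ‖B t‖ ≤ b₀
  bound_deriv : ∀ t ∈ Icc t₀ T, ‖inputDeriv B t₀ T t‖ ≤ b₁
  lipschitz_deriv : ∀ s ∈ Icc t₀ T, ∀ t ∈ Icc t₀ T,
    ‖inputDeriv B t₀ T t - inputDeriv B t₀ T s‖ ≤ b₂ * |t - s|

/-- The determinant of the `2 × 2` matrix with columns `v` and `w`. -/
def det₂ (v w : Plane) : ℝ := Matrix.det !![v 0, w 0; v 1, w 1]

/-- The uniform bracket condition
`|det(B_t, DN_t(x) B_t - B'_t)| ≥ β` for all `t ∈ [t₀, T]` and all `x`. -/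
def BracketCondition (N : ℝ → Plane → Plane) (B : ℝ → Plane) (t₀ T β : ℝ) : Prop :=
  ∀ t ∈ Icc t₀ T, ∀ x : Plane,
    β ≤ |det₂ (B t) (fderiv ℝ (N t) x (B t) - inputDeriv B t₀ T t)|

end

end PlanarControl

namespace PlanarControl

open Filter Topology

/-! The nonlinear variation of constants formula (`variation_of_constants`) turns `F_T(u)` into
`x_u(T) - x¹`, so `F_T` is the end-point map up to a constant. Expanding the controlled equation to
first order with a quadratic remainder (`norm_solution_sub_linear_le`) gives `DF_T(u) v = ∫ v(t)
P(t) B_t dt`, where `P' = -P A`, `P(T) = id` and `A(t) = DN_t(x_u(t))`. Testing with the switching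
function `φ(t) = ⟨ζ, P(t) B_t⟩` and using Cauchy–Schwarz shows `⟨M ζ, ζ⟩ = ‖DF_T(u)* ζ‖² ≥ ∫ φ²`. It
remains to bound `∫ φ²` below by `α ‖ζ‖²`.

Differentiating, `φ'(t) = -⟨ζ, P(t) w(t)⟩` with `w = A B - B'`. The control enters `φ'` only through
the trajectory, which is Lipschitz with a constant controlled by `U` and `|x⁰|`. Hence `φ` has a
Lipschitz derivative with uniform constants, although `u` is merely bounded. At `t₀` the bracket
condition makes `B` and `w` uniformly independent, and `P(t₀)` is uniformly bounded below on
functionals by Grönwall, so `|φ(t₀)| + |φ'(t₀)| ≥ c ‖ζ‖` (`norm_mul_abs_det₂_le`,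
`norm_le_norm_comp`).

A function with such bounds cannot stay small near `t₀`: either its value at `t₀` is large, or its
slope makes it large a short time later (`exists_le_integral_sq`). No compactness is used, so `α`
depends only on the listed constants. -/

/-! ### Grönwall inequalities and Carathéodory existence -/

/-- **Grönwall's inequality** in integral form. -/
theorem le_mul_exp_of_le_add_integral {f : ℝ → ℝ} {a b c K : ℝ} (hK : 0 ≤ K)
    (hf : ContinuousOn f (Icc a b))
    (h : ∀ t ∈ Icc a b, f t ≤ c + K * ∫ q in a..t, f q) :
    ∀ t ∈ Icc a b, f t ≤ c * Real.exp (K * (t - a)) := by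
  intro t ht
  have hab : a ≤ b := ht.1.trans ht.2
  have hint : IntervalIntegrable f volume a b :=
    ContinuousOn.intervalIntegrable (by rwa [uIcc_of_le hab])
  have hcont : ContinuousOn (fun t => ∫ q in a..t, f q) (Icc a b) := by
    have := intervalIntegral.continuousOn_primitive_interval
      (μ := volume) (f := f) (a := a) (b := b) (by
        rw [uIcc_of_le hab]; exact hf.integrableOn_Icc)
    rwa [uIcc_of_le hab] at this
  -- The differential Grönwall inequality is applied to the primitive of `f`: it vanishes at `a`,
  -- and its right derivative `f` is at most `K` times the primitive plus `c`.
  have key := le_gronwallBound_of_liminf_deriv_right_le (f := fun t => ∫ q in a..t, f q)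
    (f' := f) (δ := 0) (K := K) (ε := c) (a := a) (b := b) hcont
    (by
      intro x hx r hr
      have hd : HasDerivWithinAt (fun t => ∫ q in a..t, f q) (f x) (Ici x) x := by
        have hx' : IntervalIntegrable f volume a x := hint.mono_set (by
          rw [uIcc_of_le hab, uIcc_of_le hx.1]; exact Icc_subset_Icc le_rfl hx.2.le)
        have hcw : ContinuousWithinAt f (Ioi x) x :=
          ((hf x ⟨hx.1, hx.2.le⟩).mono_of_mem_nhdsWithin
            (mem_of_superset (Icc_mem_nhdsGT_of_mem hx) subset_rfl))
        refine intervalIntegral.integral_hasDerivWithinAt_right hx' ?_ hcw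
        exact ⟨Icc a b, Icc_mem_nhdsGT_of_mem hx,
          hf.aestronglyMeasurable measurableSet_Icc⟩
      exact hd.liminf_right_slope_le hr)
    (by simp)
    (by
      intro x hx
      have := h x ⟨hx.1, hx.2.le⟩
      linarith) t ht
  refine (h t ht).trans ?_
  rcases hK.eq_or_lt with rfl | hK'
  · simp
  · rw [gronwallBound_of_K_ne_0 hK'.ne'] at key
    have := mul_le_mul_of_nonneg_left key hK
    have e : K * (0 * Real.exp (K * (t - a)) + c / K * (Real.exp (K * (t - a)) - 1))
        = c * Real.exp (K * (t - a)) - c := by field_simp; ring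
    rw [e] at this
    linarith

/-- Grönwall's inequality backwards in time. -/
theorem le_mul_exp_of_le_add_integral_right {f : ℝ → ℝ} {a b c K : ℝ} (hK : 0 ≤ K)
    (hf : ContinuousOn f (Icc a b))
    (h : ∀ t ∈ Icc a b, f t ≤ c + K * ∫ q in t..b, f q) :
    ∀ t ∈ Icc a b, f t ≤ c * Real.exp (K * (b - t)) := by
  intro t ht
  have hmap : MapsTo (fun t => a + b - t) (Icc a b) (Icc a b) := fun t ht =>
    ⟨by linarith [ht.2], by linarith [ht.1]⟩
  have := le_mul_exp_of_le_add_integral (f := fun t => f (a + b - t)) (c := c) hK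
    (hf.comp (by fun_prop) hmap)
    (by
      intro t ht
      have := h _ (hmap ht)
      rw [intervalIntegral.integral_comp_sub_left (fun x => f x) (a + b)]
      simpa using this) (a + b - t) (hmap ht)
  simp only [sub_sub_cancel] at this
  convert this using 3
  ring

/-- A function that is quadratically close to itself is constant. -/
theorem eq_of_norm_sub_le_mul_sq {F : Type*} [NormedAddCommGroup F] [NormedSpace ℝ F]
    {e : ℝ → F} {a b C : ℝ} (hab : a ≤ b)
    (h : ∀ s ∈ Icc a b, ∀ t ∈ Icc a b, s ≤ t → ‖e t - e s‖ ≤ C * (t - s) ^ 2) : e b = e a := by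
  have hsq : ∀ x : ℝ, Tendsto (fun y => C * |y - x|) (𝓝[Icc a b] x) (𝓝 0) := by
    intro x
    have : Continuous fun y : ℝ => C * |y - x| := by fun_prop
    simpa using (this.tendsto x).mono_left nhdsWithin_le_nhds
  have hd : ∀ x ∈ Icc a b, HasDerivWithinAt e 0 (Icc a b) x := by
    intro x hx
    rw [hasDerivWithinAt_iff_isLittleO]
    rw [Asymptotics.isLittleO_iff]
    intro c hc
    filter_upwards [(hsq x).eventually (gt_mem_nhds hc), self_mem_nhdsWithin] with y hy hyI
    have h1 : ‖e y - e x‖ ≤ C * (y - x) ^ 2 := by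
      rcases le_total x y with hxy | hxy
      · exact h x hx y hyI hxy
      · rw [norm_sub_rev, ← sq_abs, abs_sub_comm, sq_abs]
        exact h y hyI x hx hxy
    rw [smul_zero, sub_zero, Real.norm_eq_abs]
    refine h1.trans ?_
    rw [← sq_abs, sq, ← mul_assoc]
    gcongr
  have := constant_of_derivWithin_zero (f := e) (a := a) (b := b)
    (fun x hx => (hd x hx).differentiableWithinAt)
    (fun x hx => by
      rcases hx with ⟨h1, h2⟩
      exact (hd x ⟨h1, h2.le⟩).derivWithin (uniqueDiffOn_Icc (h1.trans_lt h2) x ⟨h1, h2.le⟩))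
  exact this b (right_mem_Icc.2 hab)

/-- Carathéodory solutions of `y' = f(t, y)` exist globally for `f` Lipschitz in `y`. -/
theorem exists_integral_eq {F : Type*} [NormedAddCommGroup F] [NormedSpace ℝ F] [CompleteSpace F]
    {a b K : ℝ} (hab : a ≤ b) (hK : 0 ≤ K) (f : ℝ → F → F)
    (hlip : ∀ t ∈ Icc a b, ∀ x y, ‖f t x - f t y‖ ≤ K * ‖x - y‖)
    (hint : ∀ y : ℝ → F, ContinuousOn y (Icc a b) →
      IntervalIntegrable (fun q => f q (y q)) volume a b) (x₀ : F) :
    ∃ y : ℝ → F, ContinuousOn y (Icc a b) ∧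
      ∀ t ∈ Icc a b, y t = x₀ + ∫ q in a..t, f q (y q) := by
  -- Picard iteration in the weighted norm `sup e^{-l(t-a)} ‖y(t)‖`. The contraction ratio is `K / l
  -- ≤ 1/2` on the whole interval, so no gluing of local solutions is needed. The map `lift` removes
  -- the weight.
  set l : ℝ := 2 * K + 1 with hl
  have hl0 : 0 < l := by positivity
  let lift : C(Icc a b, F) → ℝ → F := fun y q =>
    Real.exp (l * (q - a)) • y (projIcc a b hab q)
  have hlift : ∀ y, Continuous (lift y) := fun y => by
    have : Continuous (fun q => y (projIcc a b hab q)) := y.continuous.comp continuous_projIcc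
    exact (by fun_prop : Continuous fun q : ℝ => Real.exp (l * (q - a))).smul this
  have hI : ∀ y, IntervalIntegrable (fun q => f q (lift y q)) volume a b := fun y =>
    hint _ (hlift y).continuousOn
  have hprim : ∀ y, ContinuousOn (fun t => ∫ q in a..t, f q (lift y q)) (Icc a b) := fun y => by
    have := intervalIntegral.continuousOn_primitive_interval'
      (μ := volume) (hI y) (left_mem_uIcc)
    rwa [uIcc_of_le hab] at this
  let V : C(Icc a b, F) → C(Icc a b, F) := fun y =>
    ⟨fun t => Real.exp (-(l * (t - a))) • (x₀ + ∫ q in a..(t : ℝ), f q (lift y q)), by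
      have h1 : Continuous fun t : Icc a b => ∫ q in a..(t : ℝ), f q (lift y q) :=
        continuousOn_iff_continuous_domRestrict.1 (hprim y)
      fun_prop⟩
  have hV : ContractingWith (1 / 2) V := by
    refine ⟨by norm_num, LipschitzWith.of_dist_le_mul fun y z => ?_⟩
    rw [ContinuousMap.dist_le (by positivity)]
    intro t
    have ht := t.2
    have hsub : Icc a (t : ℝ) ⊆ Icc a b := Icc_subset_Icc le_rfl ht.2
    have hIt : ∀ y, IntervalIntegrable (fun q => f q (lift y q)) volume a t := fun y =>
      (hI y).mono_set (by rwa [uIcc_of_le hab, uIcc_of_le ht.1])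
    have hpt : ∀ q ∈ Icc a (t : ℝ),
        ‖f q (lift y q) - f q (lift z q)‖ ≤ K * dist y z * Real.exp (l * (q - a)) := by
      intro q hq
      refine (hlip q (hsub hq) _ _).trans ?_
      simp only [lift]
      rw [← smul_sub, norm_smul, Real.norm_eq_abs, Real.abs_exp, ← dist_eq_norm, mul_assoc,
        mul_comm (dist y z)]
      gcongr
      exact ContinuousMap.dist_apply_le_dist _
    have hexp : ∫ q in a..(t : ℝ), Real.exp (l * (q - a)) = (Real.exp (l * (t - a)) - 1) / l := by
      have hd : ∀ q ∈ uIcc a (t : ℝ), HasDerivAt (fun q => Real.exp (l * (q - a)) / l)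
          (Real.exp (l * (q - a))) q := by
        intro q _
        have h1 : HasDerivAt (fun q => l * (q - a)) l q := by
          simpa using ((hasDerivAt_id q).sub_const a).const_mul l
        have h2 := h1.exp.div_const l
        rwa [mul_div_cancel_right₀ _ hl0.ne'] at h2
      rw [intervalIntegral.integral_eq_sub_of_hasDerivAt hd
        (by apply Continuous.intervalIntegrable; fun_prop)]
      simp
      ring
    have hmain : ‖∫ q in a..(t : ℝ), (f q (lift y q) - f q (lift z q))‖
        ≤ K * dist y z * ((Real.exp (l * (t - a)) - 1) / l) := by
      rw [← hexp, ← intervalIntegral.integral_const_mul]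
      refine intervalIntegral.norm_integral_le_of_norm_le ht.1 (ae_of_all _ fun q hq =>
        hpt q ⟨hq.1.le, hq.2⟩) ?_
      apply Continuous.intervalIntegrable; fun_prop
    rw [dist_eq_norm]
    simp only [V, ContinuousMap.coe_mk]
    rw [← smul_sub, add_sub_add_left_eq_sub, ← intervalIntegral.integral_sub (hIt y) (hIt z),
      norm_smul, Real.norm_eq_abs, Real.abs_exp]
    have hE : Real.exp (-(l * (t - a))) * Real.exp (l * (t - a)) = 1 := by
      rw [← Real.exp_add]; simp
    have hEp := Real.exp_pos (-(l * ((t : ℝ) - a)))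
    calc _ ≤ Real.exp (-(l * (t - a))) * (K * dist y z * ((Real.exp (l * (t - a)) - 1) / l)) := by
          gcongr
      _ = K / l * dist y z * (1 - Real.exp (-(l * (t - a)))) := by
          field_simp
          linear_combination (K * dist y z) * hE
      _ ≤ K / l * dist y z * 1 := by gcongr; linarith
      _ ≤ _ := by
          rw [mul_one]
          gcongr
          push_cast
          rw [div_le_div_iff₀ hl0 (by norm_num)]
          linarith
  let y := hV.fixedPoint V
  have hy : V y = y := hV.fixedPoint_isFixedPt
  refine ⟨lift y, (hlift y).continuousOn, fun t ht => ?_⟩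
  have h1 := congrArg (fun w : C(Icc a b, F) => w ⟨t, ht⟩) hy
  simp only [V, ContinuousMap.coe_mk] at h1
  simp only [lift] at h1 ⊢
  rw [projIcc_of_mem hab ht, ← h1, smul_smul, ← Real.exp_add]
  simp

/-! ### Lower `L²` bounds for functions with Lipschitz derivative -/

/-- If `|g| ≥ m` on `[p, q] ⊆ [a, b]`, then `∫ g² ≥ (q - p) m²`. -/
theorem mul_sq_le_integral_sq {g : ℝ → ℝ} {a b p q m : ℝ} (hg : ContinuousOn g (Icc a b))
    (hap : a ≤ p) (hpq : p ≤ q) (hqb : q ≤ b) (hm : 0 ≤ m) (h : ∀ t ∈ Icc p q, m ≤ |g t|) :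
    (q - p) * m ^ 2 ≤ ∫ t in a..b, g t ^ 2 := by
  have hab : a ≤ b := hap.trans (hpq.trans hqb)
  have hint : IntervalIntegrable (fun t => g t ^ 2) volume a b :=
    ContinuousOn.intervalIntegrable (by rw [uIcc_of_le hab]; exact hg.pow 2)
  calc (q - p) * m ^ 2 = ∫ t in p..q, m ^ 2 := by simp
    _ ≤ ∫ t in p..q, g t ^ 2 := by
        refine intervalIntegral.integral_mono_on hpq (by simp) (hint.mono_set ?_) fun t ht => ?_
        · rw [uIcc_of_le hab, uIcc_of_le hpq]; exact Icc_subset_Icc hap hqb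
        · rw [← sq_abs (g t)]
          exact pow_le_pow_left₀ hm (h t ht) 2
    _ ≤ _ := intervalIntegral.integral_mono_interval hap hpq hqb
        (ae_of_all _ fun t => sq_nonneg _) hint

/-- A `C^{1,1}` function that does not vanish to second order at the left end point has `L²` norm
bounded below. -/
theorem exists_le_integral_sq {a b c C : ℝ} (hab : a < b) (hc : 0 < c) (hC : 0 < C) :
    ∃ α : ℝ, 0 < α ∧ ∀ g g' : ℝ → ℝ,
      (∀ t ∈ Icc a b, HasDerivWithinAt g (g' t) (Icc a b) t) →
      (∀ t ∈ Icc a b, |g' t| ≤ C) → (∀ t ∈ Icc a b, |g' t - g' a| ≤ C * (t - a)) →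
      c ≤ |g a| + |g' a| → α ≤ ∫ t in a..b, g t ^ 2 := by
  -- At distance `h` from `a` the error `C h²` of the first-order expansion is at most `c h / 8`.
  set h : ℝ := min (min (b - a) (c / (8 * C))) 1 with hh
  have hba : 0 < b - a := sub_pos.2 hab
  have hpos : 0 < h := by positivity
  have h1 : h ≤ 1 := min_le_right _ _
  have h2 : h ≤ b - a := (min_le_left _ _).trans (min_le_left _ _)
  have h3 : C * h ≤ c / 8 := by
    have : h ≤ c / (8 * C) := (min_le_left _ _).trans (min_le_right _ _)
    rw [le_div_iff₀ (by positivity)] at this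
    linarith
  -- Over a length `l` the function `g` changes by at most `c h / 8`, so a value `3 c h / 16` at one
  -- end leaves at least `c h / 16` throughout.
  set l : ℝ := min h (c * h / (8 * C)) with hl
  have lpos : 0 < l := by positivity
  have l1 : l ≤ h := min_le_left _ _
  have l2 : C * l ≤ c * h / 8 := by
    have : l ≤ c * h / (8 * C) := min_le_right _ _
    rw [le_div_iff₀ (by positivity)] at this
    linarith
  refine ⟨l * (c * h / 16) ^ 2, by positivity, fun g g' hd hb hL hn => ?_⟩
  have hgc : ContinuousOn g (Icc a b) := fun t ht => (hd t ht).continuousWithinAt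
  have hLip : ∀ s ∈ Icc a b, ∀ t ∈ Icc a b, |g t - g s| ≤ C * |t - s| := fun s hs t ht =>
    (convex_Icc a b).norm_image_sub_le_of_norm_hasDerivWithin_le hd hb hs ht
  have hexp : |g (a + h) - g a - g' a * h| ≤ C * h * h := by
    have := norm_image_sub_le_of_norm_deriv_le_segment' (a := a) (b := a + h) (C := C * h)
      (f := fun t => g t - g' a * (t - a)) (f' := fun t => g' t - g' a)
      (by
        intro t ht
        have hsub : Icc a (a + h) ⊆ Icc a b := Icc_subset_Icc le_rfl (by linarith)
        refine ((hd t (hsub ht)).mono hsub).sub ?_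
        simpa using ((((hasDerivAt_id t).sub_const a).const_mul (g' a)).hasDerivWithinAt))
      (by
        intro t ht
        refine (hL t ⟨ht.1, by linarith [ht.2]⟩).trans ?_
        have := ht.2
        gcongr
        linarith) (a + h) ⟨by linarith, le_rfl⟩
    simp only [add_sub_cancel_left, sub_self, mul_zero, sub_zero, Real.norm_eq_abs] at this
    convert this using 2
    ring
  -- If both values were small, then `|g' a| ≥ c / 2`, and the linear term `c h / 2` would be
  -- strictly less than `2 · 3 c h / 16 + c h / 8 = c h / 2`.
  have hor : 3 * c * h / 16 ≤ |g a| ∨ 3 * c * h / 16 ≤ |g (a + h)| := by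
    by_contra! hcon
    obtain ⟨u1, u2⟩ := hcon
    have hch : c * h ≤ c := mul_le_of_le_one_right hc.le h1
    have v1 : c / 2 ≤ |g' a| := by linarith
    have v2 : c / 2 * h ≤ |g' a * h| := by
      rw [abs_mul, abs_of_pos hpos]; gcongr
    have v3 : |g' a * h| ≤ |g (a + h)| + |g a| + |g (a + h) - g a - g' a * h| := by
      have : g' a * h = g (a + h) - g a - (g (a + h) - g a - g' a * h) := by ring
      calc |g' a * h| = |g (a + h) - g a - (g (a + h) - g a - g' a * h)| := by rw [← this]
        _ ≤ _ := (abs_sub _ _).trans (by gcongr; exact abs_sub _ _)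
    have v4 : C * h * h ≤ c / 8 * h := by gcongr
    linarith
  rcases hor with ho | ho
  · have := mul_sq_le_integral_sq (p := a) (q := a + l) (m := c * h / 16) hgc le_rfl
      (by linarith) (by linarith) (by positivity) (fun t ht => by
        have w1 := hLip a ⟨le_rfl, hab.le⟩ t ⟨ht.1, by linarith [ht.2]⟩
        have w2 : C * |t - a| ≤ C * l := by
          gcongr; rw [abs_of_nonneg (by linarith [ht.1])]; linarith [ht.2]
        have w3 := abs_sub_abs_le_abs_sub (g a) (g t)
        rw [abs_sub_comm] at w3
        linarith)
    simpa using this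
  · have := mul_sq_le_integral_sq (p := a + h - l) (q := a + h) (m := c * h / 16) hgc
      (by linarith) (by linarith) (by linarith) (by positivity) (fun t ht => by
        have w1 := hLip (a + h) ⟨by linarith, by linarith⟩ t
          ⟨by linarith [ht.1], by linarith [ht.2]⟩
        have w2 : C * |t - (a + h)| ≤ C * l := by
          gcongr; rw [abs_of_nonpos (by linarith [ht.2])]; linarith [ht.1]
        have w3 := abs_sub_abs_le_abs_sub (g (a + h)) (g t)
        rw [abs_sub_comm] at w3
        linarith)
    simpa using this

/-! ### Determinants and functionals in the plane -/

theorem abs_det₂_le (v w : Plane) : |det₂ v w| ≤ 2 * ‖v‖ * ‖w‖ := by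
  have h := fun (x : Plane) (i : Fin 2) => PiLp.norm_apply_le x i
  simp only [Real.norm_eq_abs] at h
  rw [det₂, Matrix.det_fin_two_of]
  calc |v 0 * w 1 - w 0 * v 1| ≤ |v 0| * |w 1| + |w 0| * |v 1| := by
        rw [← abs_mul, ← abs_mul]; exact abs_sub _ _
    _ ≤ ‖v‖ * ‖w‖ + ‖w‖ * ‖v‖ := by gcongr <;> exact h _ _
    _ = _ := by ring

/-- A functional is controlled by its values on two vectors with large determinant. -/
theorem norm_mul_abs_det₂_le (L : Plane →L[ℝ] ℝ) (v w : Plane) :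
    ‖L‖ * |det₂ v w| ≤ 2 * (‖v‖ + ‖w‖) * (|L v| + |L w|) := by
  rw [← abs_of_nonneg (norm_nonneg L), ← abs_mul, mul_comm, ← Real.norm_eq_abs (_ * _),
    norm_mul, norm_norm, ← norm_smul]
  refine ContinuousLinearMap.opNorm_le_bound _ (by positivity) fun x => ?_
  -- Cramer's rule, in a form that does not divide by the determinant.
  have hx : det₂ v w • x = det₂ x w • v + det₂ v x • w := by
    ext i
    fin_cases i <;> simp [det₂, Matrix.det_fin_two_of] <;> ring
  rw [smul_apply, ← map_smul, hx, map_add, map_smul, map_smul]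
  have h1 := abs_det₂_le x w
  have h2 := abs_det₂_le v x
  calc ‖det₂ x w • L v + det₂ v x • L w‖ ≤ |det₂ x w| * |L v| + |det₂ v x| * |L w| := by
        refine (norm_add_le _ _).trans ?_
        simp
    _ ≤ (2 * ‖x‖ * ‖w‖) * |L v| + (2 * ‖v‖ * ‖x‖) * |L w| := by gcongr
    _ ≤ _ := by
        have : 0 ≤ ‖x‖ * ‖v‖ * |L v| := by positivity
        have : 0 ≤ ‖x‖ * ‖w‖ * |L w| := by positivity
        linarith

/-! ### Linear backward equations and their resolvents -/

theorem intervalIntegrable_of_Icc {F : Type*} [NormedAddCommGroup F] [NormedSpace ℝ F]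
    {f : ℝ → F} {a b s t : ℝ} (hab : a ≤ b) (h : IntervalIntegrable f volume a b)
    (hs : s ∈ Icc a b) (ht : t ∈ Icc a b) : IntervalIntegrable f volume s t :=
  h.mono_set (by
    rw [uIcc_of_le hab]
    exact uIcc_subset_Icc hs ht)

theorem intervalIntegrable_clm_apply {M : ℝ → Plane →L[ℝ] Plane} {b : ℝ → Plane} {s T : ℝ}
    (hsT : s ≤ T) (hM : ContinuousOn M (Icc s T)) (hb : IntervalIntegrable b volume s T) :
    IntervalIntegrable (fun q => M q (b q)) volume s T := by
  obtain ⟨E, hE⟩ := isCompact_Icc.exists_bound_of_continuousOn hM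
  rw [intervalIntegrable_iff_integrableOn_Icc_of_le hsT] at hb ⊢
  refine Integrable.mono' (hb.norm.const_mul E) ?_ ?_
  · exact (ContinuousLinearMap.apply ℝ Plane).flip.aestronglyMeasurable_comp₂
      (hM.aestronglyMeasurable measurableSet_Icc) hb.aestronglyMeasurable
  · filter_upwards [ae_restrict_mem measurableSet_Icc] with q hq
    refine (ContinuousLinearMap.le_opNorm _ _).trans ?_
    gcongr
    exact hE q hq

/-- `P` solves the backward equation `P' = -P A`, `P(T) = id` on `[s, T]`. -/
structure IsResolvent (A : ℝ → Plane →L[ℝ] Plane) (s T : ℝ) (P : ℝ → Plane →L[ℝ] Plane) :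
    Prop where
  continuousOn : ContinuousOn P (Icc s T)
  eq_integral : ∀ t ∈ Icc s T,
    P t = ContinuousLinearMap.id ℝ Plane + ∫ q in t..T, (P q).comp (A q)

section Resolvent

variable {A : ℝ → Plane →L[ℝ] Plane} {P : ℝ → Plane →L[ℝ] Plane} {s T K : ℝ}

/-- The reflection `t ↦ s + T - t` turns the terminal value problem into an initial value problem
for operators, to which the Picard argument applies. -/
theorem exists_isResolvent (hsT : s ≤ T) (hK : 0 ≤ K) (hA : ContinuousOn A (Icc s T))
    (hAK : ∀ t ∈ Icc s T, ‖A t‖ ≤ K) : ∃ P, IsResolvent A s T P := by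
  have hmap : MapsTo (fun t => s + T - t) (Icc s T) (Icc s T) := fun t ht =>
    ⟨by linarith [ht.2], by linarith [ht.1]⟩
  have hA' : ContinuousOn (fun t => A (s + T - t)) (Icc s T) := hA.comp (by fun_prop) hmap
  obtain ⟨Q, hQ, hQe⟩ := exists_integral_eq (F := Plane →L[ℝ] Plane) hsT hK
    (fun t X => X.comp (A (s + T - t)))
    (fun t ht X Y => by
      rw [← ContinuousLinearMap.sub_comp, mul_comm]
      refine (ContinuousLinearMap.opNorm_comp_le _ _).trans ?_
      gcongr
      exact hAK _ (hmap ht))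
    (fun y hy => ContinuousOn.intervalIntegrable (by
      rw [uIcc_of_le hsT]
      exact hy.clm_comp hA'))
    (ContinuousLinearMap.id ℝ Plane)
  refine ⟨fun t => Q (s + T - t), hQ.comp (by fun_prop) hmap, fun t ht => ?_⟩
  rw [hQe _ (hmap ht)]
  congr 1
  have := intervalIntegral.integral_comp_sub_left (a := t) (b := T)
    (fun q => (Q q).comp (A (s + T - q))) (s + T)
  simpa using this.symm

namespace IsResolvent

theorem mono (hP : IsResolvent A s T P) {s' : ℝ} (h : s ≤ s') : IsResolvent A s' T P :=
  ⟨hP.continuousOn.mono (Icc_subset_Icc h le_rfl),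
    fun t ht => hP.eq_integral t ⟨h.trans ht.1, ht.2⟩⟩

theorem apply_right (hP : IsResolvent A s T P) (hsT : s ≤ T) :
    P T = ContinuousLinearMap.id ℝ Plane := by
  simpa using hP.eq_integral T (right_mem_Icc.2 hsT)

theorem intervalIntegrable (hP : IsResolvent A s T P) (hA : ContinuousOn A (Icc s T))
    {t t' : ℝ} (ht : t ∈ Icc s T) (ht' : t' ∈ Icc s T) :
    IntervalIntegrable (fun q => (P q).comp (A q)) volume t t' :=
  ContinuousOn.intervalIntegrable
    ((hP.continuousOn.clm_comp hA).mono (uIcc_subset_Icc ht ht'))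

theorem sub_eq (hP : IsResolvent A s T P) (hA : ContinuousOn A (Icc s T))
    {t t' : ℝ} (ht : t ∈ Icc s T) (ht' : t' ∈ Icc s T) :
    P t' - P t = -∫ q in t..t', (P q).comp (A q) := by
  have hT : T ∈ Icc s T := ⟨ht.1.trans ht.2, le_rfl⟩
  rw [hP.eq_integral t ht, hP.eq_integral t' ht', add_sub_add_left_eq_sub,
    ← intervalIntegral.integral_add_adjacent_intervals (hP.intervalIntegrable hA ht ht')
      (hP.intervalIntegrable hA ht' hT)]
  abel

theorem norm_le (hP : IsResolvent A s T P) (hK : 0 ≤ K)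
    (hAK : ∀ t ∈ Icc s T, ‖A t‖ ≤ K) {t : ℝ} (ht : t ∈ Icc s T) :
    ‖P t‖ ≤ Real.exp (K * (T - t)) := by
  have := le_mul_exp_of_le_add_integral_right (f := fun t => ‖P t‖) (c := 1) hK
    hP.continuousOn.norm (fun t ht => by
      have hcn : IntervalIntegrable (fun q => K * ‖P q‖) volume t T :=
        ContinuousOn.intervalIntegrable (by
          rw [uIcc_of_le ht.2]
          exact continuousOn_const.mul
            (hP.continuousOn.norm.mono (Icc_subset_Icc ht.1 le_rfl)))
      rw [hP.eq_integral t ht, ← intervalIntegral.integral_const_mul]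
      refine (norm_add_le _ _).trans (add_le_add ContinuousLinearMap.norm_id_le ?_)
      refine intervalIntegral.norm_integral_le_of_norm_le ht.2 (ae_of_all _ fun q hq => ?_) hcn
      refine (ContinuousLinearMap.opNorm_comp_le _ _).trans ?_
      rw [mul_comm]
      gcongr
      exact hAK q ⟨ht.1.trans hq.1.le, hq.2⟩) t ht
  simpa using this

theorem norm_le' (hP : IsResolvent A s T P) (hK : 0 ≤ K)
    (hAK : ∀ t ∈ Icc s T, ‖A t‖ ≤ K) {t : ℝ} (ht : t ∈ Icc s T) :
    ‖P t‖ ≤ Real.exp (K * (T - s)) :=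
  (hP.norm_le hK hAK ht).trans (by
    gcongr
    exact ht.1)

theorem norm_sub_le_mul_abs (hP : IsResolvent A s T P) (hA : ContinuousOn A (Icc s T)) (hK : 0 ≤ K)
    (hAK : ∀ t ∈ Icc s T, ‖A t‖ ≤ K) {t t' : ℝ} (ht : t ∈ Icc s T) (ht' : t' ∈ Icc s T) :
    ‖P t' - P t‖ ≤ Real.exp (K * (T - s)) * K * |t' - t| := by
  rw [hP.sub_eq hA ht ht', norm_neg]
  refine intervalIntegral.norm_integral_le_of_norm_le_const fun q hq => ?_
  have hq' : q ∈ Icc s T := uIcc_subset_Icc ht ht' (uIoc_subset_uIcc hq)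
  refine (ContinuousLinearMap.opNorm_comp_le _ _).trans ?_
  gcongr
  · exact hP.norm_le' hK hAK hq'
  · exact hAK q hq'

/-- Stability in the coefficients: split `P A - P' A' = P (A - A') + (P - P') A'` and apply the
backward Grönwall inequality. -/
theorem norm_sub_le_of_norm_sub_le {A' P' : ℝ → Plane →L[ℝ] Plane} {ε : ℝ}
    (hP : IsResolvent A s T P) (hP' : IsResolvent A' s T P')
    (hA : ContinuousOn A (Icc s T)) (hA' : ContinuousOn A' (Icc s T)) (hK : 0 ≤ K)
    (hAK : ∀ t ∈ Icc s T, ‖A t‖ ≤ K) (hAK' : ∀ t ∈ Icc s T, ‖A' t‖ ≤ K)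
    (hε : ∀ t ∈ Icc s T, ‖A t - A' t‖ ≤ ε) {t : ℝ} (ht : t ∈ Icc s T) :
    ‖P t - P' t‖ ≤ Real.exp (K * (T - s)) * ε * (T - s) * Real.exp (K * (T - s)) := by
  have hε0 : 0 ≤ ε := (norm_nonneg _).trans (hε t ht)
  have hsT : s ≤ T := ht.1.trans ht.2
  have := le_mul_exp_of_le_add_integral_right (f := fun t => ‖P t - P' t‖)
    (c := Real.exp (K * (T - s)) * ε * (T - s)) hK
    (hP.continuousOn.sub hP'.continuousOn).norm (fun t ht => by
      have hT : T ∈ Icc s T := right_mem_Icc.2 hsT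
      have hcn : IntervalIntegrable
          (fun q => Real.exp (K * (T - s)) * ε + K * ‖P q - P' q‖) volume t T :=
        ContinuousOn.intervalIntegrable (by
          rw [uIcc_of_le ht.2]
          exact continuousOn_const.add (continuousOn_const.mul
            ((hP.continuousOn.sub hP'.continuousOn).norm.mono (Icc_subset_Icc ht.1 le_rfl))))
      have hcn' : IntervalIntegrable (fun q => K * ‖P q - P' q‖) volume t T :=
        ContinuousOn.intervalIntegrable (by
          rw [uIcc_of_le ht.2]
          exact (continuousOn_const.mul
            ((hP.continuousOn.sub hP'.continuousOn).norm.mono (Icc_subset_Icc ht.1 le_rfl))))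
      rw [hP.eq_integral t ht, hP'.eq_integral t ht, add_sub_add_left_eq_sub,
        ← intervalIntegral.integral_sub (hP.intervalIntegrable hA ht hT)
          (hP'.intervalIntegrable hA' ht hT)]
      have hb := intervalIntegral.norm_integral_le_of_norm_le (μ := volume) ht.2
        (f := fun q => (P q).comp (A q) - (P' q).comp (A' q)) (ae_of_all _ fun q hq => ?_) hcn
      · refine hb.trans ?_
        rw [intervalIntegral.integral_add (by simp) hcn',
          intervalIntegral.integral_const_mul K, intervalIntegral.integral_const, smul_eq_mul]
        have : (T - t) * (Real.exp (K * (T - s)) * ε)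
            ≤ Real.exp (K * (T - s)) * ε * (T - s) := by
          rw [mul_comm]
          gcongr
          exact ht.1
        linarith
      · have hq' : q ∈ Icc s T := ⟨ht.1.trans hq.1.le, hq.2⟩
        have e : (P q).comp (A q) - (P' q).comp (A' q)
            = (P q).comp (A q - A' q) + (P q - P' q).comp (A' q) := by
          rw [ContinuousLinearMap.comp_sub, ContinuousLinearMap.sub_comp]; abel
        rw [e]
        refine (norm_add_le _ _).trans (add_le_add ?_ ?_)
        · refine (ContinuousLinearMap.opNorm_comp_le _ _).trans ?_
          gcongr
          · exact hP.norm_le' hK hAK hq'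
          · exact hε q hq'
        · refine (ContinuousLinearMap.opNorm_comp_le _ _).trans ?_
          rw [mul_comm]
          gcongr
          exact hAK' q hq') t ht
  refine this.trans ?_
  have := ht.1
  have : 0 ≤ T - s := by linarith
  gcongr

/-- The resolvent is bounded below on functionals. -/
theorem norm_le_norm_comp (hP : IsResolvent A s T P) (hA : ContinuousOn A (Icc s T)) (hK : 0 ≤ K)
    (hAK : ∀ t ∈ Icc s T, ‖A t‖ ≤ K) (hsT : s ≤ T) (L : Plane →L[ℝ] ℝ) :
    ‖L‖ ≤ ‖L.comp (P s)‖ * Real.exp (K * (T - s)) := by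
  have hs : s ∈ Icc s T := left_mem_Icc.2 hsT
  have hcont : ContinuousOn (fun t => L.comp (P t)) (Icc s T) :=
    continuousOn_const.clm_comp hP.continuousOn
  -- The curve `t ↦ L ∘ P t` solves a linear equation, so it grows at most exponentially from `s` to
  -- `T`, where it equals `L`. No inverse of `P s` is needed.
  have := le_mul_exp_of_le_add_integral (f := fun t => ‖L.comp (P t)‖)
    (c := ‖L.comp (P s)‖) hK hcont.norm (fun t ht => by
      have e : L.comp (P t) = L.comp (P s) - ∫ q in s..t, (L.comp (P q)).comp (A q) := by
        have h1 : P t = P s - ∫ q in s..t, (P q).comp (A q) := by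
          have := hP.sub_eq hA hs ht
          rw [sub_eq_iff_eq_add] at this
          rw [this]; abel
        have h2 := ((ContinuousLinearMap.compL ℝ Plane Plane ℝ L).intervalIntegral_comp_comm
          (hP.intervalIntegrable hA hs ht))
        simp only [ContinuousLinearMap.compL_apply] at h2
        rw [h1, ContinuousLinearMap.comp_sub, ← h2]
        rfl
      have hcn : IntervalIntegrable (fun q => K * ‖L.comp (P q)‖) volume s t :=
        ContinuousOn.intervalIntegrable (by
          rw [uIcc_of_le ht.1]
          exact continuousOn_const.mul (hcont.norm.mono (Icc_subset_Icc le_rfl ht.2)))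
      rw [← intervalIntegral.integral_const_mul]
      conv_lhs => rw [e]
      refine (norm_sub_le _ _).trans (add_le_add le_rfl ?_)
      refine intervalIntegral.norm_integral_le_of_norm_le ht.1 (ae_of_all _ fun q hq => ?_) hcn
      refine (ContinuousLinearMap.opNorm_comp_le _ _).trans ?_
      rw [mul_comm]
      gcongr
      exact hAK q ⟨hq.1.le, hq.2.trans ht.2⟩) T (right_mem_Icc.2 hsT)
  simpa [hP.apply_right hsT] using this

/-- Variation of constants: the resolvent represents the final value of a linear equation. -/
theorem apply_eq {z b : ℝ → Plane} {m : ℝ} (hP : IsResolvent A s T P)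
    (hA : ContinuousOn A (Icc s T)) (hK : 0 ≤ K) (hAK : ∀ t ∈ Icc s T, ‖A t‖ ≤ K) (hsT : s ≤ T)
    (hz : ContinuousOn z (Icc s T)) (hb : IntervalIntegrable b volume s T)
    (hbm : ∀ᵐ q, q ∈ Icc s T → ‖b q‖ ≤ m)
    (hzb : ∀ t ∈ Icc s T, z t = z s + ∫ q in s..t, (A q (z q) + b q)) :
    z T = P s (z s) + ∫ q in s..T, P q (b q) := by
  have hs : s ∈ Icc s T := left_mem_Icc.2 hsT
  have hT : T ∈ Icc s T := right_mem_Icc.2 hsT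
  set m' := max m 0 with hm'
  have hm0 : 0 ≤ m' := le_max_right _ _
  obtain ⟨Z, hZ⟩ := isCompact_Icc.exists_bound_of_continuousOn hz
  have hZ0 : 0 ≤ Z := (norm_nonneg _).trans (hZ s hs)
  set E := Real.exp (K * (T - s)) with hE
  have hAz : ContinuousOn (fun q => A q (z q)) (Icc s T) := hA.clm_apply hz
  have hAzi : IntervalIntegrable (fun q => A q (z q)) volume s T :=
    ContinuousOn.intervalIntegrable (by rwa [uIcc_of_le hsT])
  have hPb : IntervalIntegrable (fun q => P q (b q)) volume s T :=
    intervalIntegrable_clm_apply hsT hP.continuousOn hb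
  have hsub : ∀ t ∈ Icc s T, ∀ t' ∈ Icc s T, z t' - z t = ∫ q in t..t', (A q (z q) + b q) := by
    intro t ht t' ht'
    have hi := hAzi.add hb
    rw [hzb t ht, hzb t' ht', add_sub_add_left_eq_sub, sub_eq_iff_eq_add, add_comm]
    exact (intervalIntegral.integral_add_adjacent_intervals
      (intervalIntegrable_of_Icc hsT hi hs ht) (intervalIntegrable_of_Icc hsT hi ht ht')).symm
  have hbd : ∀ᵐ q, q ∈ Icc s T → ‖A q (z q) + b q‖ ≤ K * Z + m' := by
    filter_upwards [hbm] with q hq hqI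
    refine (norm_add_le _ _).trans (add_le_add ?_ ((hq hqI).trans (le_max_left _ _)))
    refine (ContinuousLinearMap.le_opNorm _ _).trans ?_
    gcongr
    · exact hAK q hqI
    · exact hZ q hqI
  have hzL : ∀ t ∈ Icc s T, ∀ t' ∈ Icc s T, ‖z t' - z t‖ ≤ (K * Z + m') * |t' - t| := by
    intro t ht t' ht'
    rw [hsub t ht t' ht']
    refine intervalIntegral.norm_integral_le_of_norm_le_const_ae ?_
    filter_upwards [hbd] with q hq hqI
    exact hq (uIcc_subset_Icc ht ht' (uIoc_subset_uIcc hqI))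
  -- The product rule for `P z` is replaced by a quadratic estimate of increments, since `b` is only
  -- integrable and essentially bounded. Both `P` and `z` are Lipschitz, and the first-order terms
  -- cancel.
  have key := eq_of_norm_sub_le_mul_sq (e := fun t => P t (z t) - ∫ q in s..t, P q (b q))
    (C := 2 * (E * K * (K * Z + m'))) hsT (fun t ht t' ht' htt => by
      have i1 := intervalIntegrable_of_Icc hsT hPb ht ht'
      have i2 := intervalIntegrable_of_Icc hsT (hAzi.add hb) ht ht'
      have i3 := hP.intervalIntegrable hA ht ht'
      have e1 : P t' (z t') - (∫ q in s..t', P q (b q)) - (P t (z t) - ∫ q in s..t, P q (b q))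
          = (P t' - P t) (z t') + P t (z t' - z t) - ∫ q in t..t', P q (b q) := by
        rw [← intervalIntegral.integral_add_adjacent_intervals
          (intervalIntegrable_of_Icc hsT hPb hs ht) i1, sub_apply, map_sub]
        abel
      have e2 : (P t' - P t) (z t') = -∫ q in t..t', P q (A q (z t')) := by
        rw [hP.sub_eq hA ht ht']
        have := ContinuousLinearMap.intervalIntegral_apply i3 (z t')
        simp only [neg_apply, this, ContinuousLinearMap.comp_apply]
      have e3 : P t (z t' - z t) = ∫ q in t..t', P t (A q (z q) + b q) := by
        rw [hsub t ht t' ht', (P t).intervalIntegral_comp_comm i2]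
      have i4 : IntervalIntegrable (fun q => P q (A q (z t'))) volume t t' := by
        refine ContinuousOn.intervalIntegrable (ContinuousOn.mono ?_ (uIcc_subset_Icc ht ht'))
        exact hP.continuousOn.clm_apply (hA.clm_apply continuousOn_const)
      have i5 : IntervalIntegrable (fun q => P t (A q (z q) + b q)) volume t t' :=
        ⟨(P t).integrable_comp i2.1, (P t).integrable_comp i2.2⟩
      rw [e1, e2, e3, neg_add_eq_sub, ← intervalIntegral.integral_sub i5 i4,
        ← intervalIntegral.integral_sub (i5.sub i4) i1]
      have hfin := intervalIntegral.norm_integral_le_of_norm_le_const_ae (a := t) (b := t')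
        (C := 2 * (E * K * (K * Z + m')) * (t' - t))
        (f := fun q => P t (A q (z q) + b q) - P q (A q (z t')) - P q (b q)) (by
          filter_upwards [hbd] with q hq hqI
          have hqI' := uIcc_subset_Icc ht ht' (uIoc_subset_uIcc hqI)
          rw [uIoc_of_le htt] at hqI
          have e4 : P t (A q (z q) + b q) - P q (A q (z t')) - P q (b q)
              = P q (A q (z q - z t')) - (P q - P t) (A q (z q) + b q) := by
            simp only [sub_apply, map_sub, map_add]; abel
          rw [e4]
          have n1 : ‖P q (A q (z q - z t'))‖ ≤ E * (K * ((K * Z + m') * (t' - t))) := by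
            refine (ContinuousLinearMap.le_opNorm _ _).trans ?_
            gcongr
            · exact hP.norm_le' hK hAK hqI'
            refine (ContinuousLinearMap.le_opNorm _ _).trans ?_
            gcongr
            · exact hAK q hqI'
            refine (hzL t' ht' q hqI').trans ?_
            gcongr
            rw [abs_of_nonpos (by linarith [hqI.2])]
            linarith [hqI.1]
          have n2 : ‖(P q - P t) (A q (z q) + b q)‖ ≤ (E * K * (t' - t)) * (K * Z + m') := by
            refine (ContinuousLinearMap.le_opNorm _ _).trans ?_
            have : 0 ≤ t' - t := by linarith
            gcongr
            · refine (hP.norm_sub_le_mul_abs hA hK hAK ht hqI').trans ?_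
              gcongr
              rw [abs_of_nonneg (by linarith [hqI.1])]
              linarith [hqI.2]
            · exact hq hqI'
          refine (norm_sub_le _ _).trans ((add_le_add n1 n2).trans (le_of_eq (by ring))))
      refine hfin.trans (le_of_eq ?_)
      rw [abs_of_nonneg (by linarith)]
      ring)
  simp only [hP.apply_right hsT, ContinuousLinearMap.id_apply, intervalIntegral.integral_same,
    sub_zero] at key
  rw [← key]
  abel

end IsResolvent

end Resolvent

/-! ### Trajectories of the drift: existence and a priori estimates -/

theorem timeMeasure_eq (t₀ T : ℝ) : timeMeasure t₀ T = volume.restrict (Icc t₀ T) :=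
  Measure.restrict_congr_set Ioo_ae_eq_Icc

theorem ae_timeMeasure_iff {t₀ T : ℝ} {p : ℝ → Prop} :
    (∀ᵐ q ∂timeMeasure t₀ T, p q) ↔ ∀ᵐ q, q ∈ Icc t₀ T → p q := by
  rw [timeMeasure_eq, ae_restrict_iff' measurableSet_Icc]

theorem isSolution_add_zero {N : ℝ → Plane → Plane} {s T : ℝ} {x : Plane} {y : ℝ → Plane} :
    IsSolution (fun t x => N t x + (0 : ℝ → Plane) t) s T x y ↔ IsSolution N s T x y := by
  simp

namespace IsSolution

variable {f : ℝ → Plane → Plane} {s T : ℝ} {x : Plane} {y : ℝ → Plane}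

theorem apply_left (h : IsSolution f s T x y) : y s = x := by
  simpa using h.eq_integral s left_mem_uIcc

theorem sub_eq (h : IsSolution f s T x y) (hsT : s ≤ T) {t t' : ℝ} (ht : t ∈ Icc s T)
    (ht' : t' ∈ Icc s T) : y t' - y t = ∫ q in t..t', f q (y q) := by
  have hs := left_mem_Icc.2 hsT
  rw [h.eq_integral t (by rwa [uIcc_of_le hsT]), h.eq_integral t' (by rwa [uIcc_of_le hsT]),
    add_sub_add_left_eq_sub, sub_eq_iff_eq_add, add_comm]
  exact (intervalIntegral.integral_add_adjacent_intervals
      (intervalIntegrable_of_Icc hsT h.integrable hs ht)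
      (intervalIntegrable_of_Icc hsT h.integrable ht ht')).symm

theorem mono (h : IsSolution f s T x y) {s' : ℝ} (hs : s ≤ s') (hT : s' ≤ T) :
    IsSolution f s' T (y s') y := by
  have hsT := hs.trans hT
  refine ⟨h.continuousOn.mono ?_, intervalIntegrable_of_Icc hsT h.integrable ⟨hs, hT⟩
    (right_mem_Icc.2 hsT), fun r hr => ?_⟩
  · rw [uIcc_of_le hT, uIcc_of_le hsT]; exact Icc_subset_Icc hs le_rfl
  · rw [uIcc_of_le hT] at hr
    rw [← h.sub_eq hsT ⟨hs, hT⟩ ⟨hs.trans hr.1, hr.2⟩]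
    abel

end IsSolution

theorem solution_spec {f : ℝ → Plane → Plane} {s T : ℝ} {x : Plane}
    (h : ∃ y, IsSolution f s T x y) : IsSolution f s T x (solution f s T x) := by
  rw [solution, dif_pos h]
  exact h.choose_spec

namespace DriftAssumption

variable {t₀ T ν Λ₁ Λ₂ Λ₃ : ℝ} {N : ℝ → Plane → Plane}

theorem nonneg₁ (hN : DriftAssumption t₀ T ν Λ₁ Λ₂ Λ₃ N) (hT : t₀ ≤ T) : 0 ≤ Λ₁ :=
  (norm_nonneg _).trans (hN.bound_fderiv T (right_mem_Icc.2 hT) 0)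

theorem nonneg₂ (hN : DriftAssumption t₀ T ν Λ₁ Λ₂ Λ₃ N) (hT : t₀ ≤ T) : 0 ≤ Λ₂ :=
  (norm_nonneg (fderiv ℝ (fderiv ℝ (N T)) 0)).trans (hN.bound_fderiv_two T (right_mem_Icc.2 hT) 0)

theorem norm_sub_le (hN : DriftAssumption t₀ T ν Λ₁ Λ₂ Λ₃ N) {t : ℝ} (ht : t ∈ Icc t₀ T)
    (x y : Plane) : ‖N t x - N t y‖ ≤ Λ₁ * ‖x - y‖ :=
  convex_univ.norm_image_sub_le_of_norm_fderiv_le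
    (fun z _ => ((hN.contDiff t ht).differentiable (by norm_num)) z)
    (fun z _ => hN.bound_fderiv t ht z) (mem_univ y) (mem_univ x)

theorem norm_fderiv_sub_le (hN : DriftAssumption t₀ T ν Λ₁ Λ₂ Λ₃ N) {t : ℝ} (ht : t ∈ Icc t₀ T)
    (x y : Plane) : ‖fderiv ℝ (N t) x - fderiv ℝ (N t) y‖ ≤ Λ₂ * ‖x - y‖ :=
  convex_univ.norm_image_sub_le_of_norm_fderiv_le
    (fun z _ => (((hN.contDiff t ht).fderiv_right (m := 1) (by norm_num)).differentiable
      (by norm_num)) z)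
    (fun z _ => hN.bound_fderiv_two t ht z) (mem_univ y) (mem_univ x)

/-- The mean value inequality on the segment from `y` to `x`, where `DN` differs from its value at
`y` by at most `Λ₂ ‖x - y‖`. The sharp factor `1/2` is not needed. -/
theorem norm_remainder_le (hN : DriftAssumption t₀ T ν Λ₁ Λ₂ Λ₃ N) {t : ℝ} (ht : t ∈ Icc t₀ T)
    (x y : Plane) : ‖N t x - N t y - fderiv ℝ (N t) y (x - y)‖ ≤ Λ₂ * ‖x - y‖ ^ 2 := by
  have h2 := hN.nonneg₂ (ht.1.trans ht.2)
  have := (convex_segment (𝕜 := ℝ) y x).norm_image_sub_le_of_norm_fderiv_le'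
    (f := N t) (φ := fderiv ℝ (N t) y) (C := Λ₂ * ‖x - y‖)
    (fun z _ => ((hN.contDiff t ht).differentiable (by norm_num)) z)
    (fun z hz => (hN.norm_fderiv_sub_le ht z y).trans (by
      gcongr
      exact norm_sub_le_of_mem_segment hz))
    (left_mem_segment _ _ _) (right_mem_segment _ _ _)
  rwa [mul_assoc, ← sq] at this

theorem norm_fderiv_sub_le' (hN : DriftAssumption t₀ T ν Λ₁ Λ₂ Λ₃ N) {s t : ℝ}
    (hs : s ∈ Icc t₀ T) (ht : t ∈ Icc t₀ T) (x y : Plane) :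
    ‖fderiv ℝ (N t) x - fderiv ℝ (N s) y‖ ≤ Λ₃ * |t - s| + Λ₂ * ‖x - y‖ := by
  rw [← sub_add_sub_cancel _ (fderiv ℝ (N s) x)]
  exact (norm_add_le _ _).trans
    (add_le_add (hN.lipschitz_fderiv x s hs t ht) (hN.norm_fderiv_sub_le hs x y))

theorem continuousOn_fderiv (hN : DriftAssumption t₀ T ν Λ₁ Λ₂ Λ₃ N) {s : ℝ} (hs : t₀ ≤ s)
    {y : ℝ → Plane} (hy : ContinuousOn y (Icc s T)) :
    ContinuousOn (fun q => fderiv ℝ (N q) (y q)) (Icc s T) := by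
  intro q hq
  have h1 : ContinuousWithinAt (fun t => Λ₃ * |t - q| + Λ₂ * ‖y t - y q‖) (Icc s T) q := by
    have := hy q hq
    fun_prop
  rw [ContinuousWithinAt, tendsto_iff_norm_sub_tendsto_zero]
  refine squeeze_zero' (Eventually.of_forall fun _ => norm_nonneg _) ?_
    (by simpa using h1.tendsto)
  filter_upwards [self_mem_nhdsWithin] with t ht
  exact hN.norm_fderiv_sub_le' ⟨hs.trans hq.1, hq.2⟩ ⟨hs.trans ht.1, ht.2⟩ _ _

/-- `N_t(x)` is only bounded measurable in `t`, but `N_t(x) - N_t(0)` inherits Lipschitz dependence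
on `t` from `DN`. Along a continuous curve the drift is therefore a continuous function plus
`N_t(0)`, which settles measurability. -/
theorem norm_increment_le (hN : DriftAssumption t₀ T ν Λ₁ Λ₂ Λ₃ N) {s t : ℝ}
    (hs : s ∈ Icc t₀ T) (ht : t ∈ Icc t₀ T) (x y : Plane) :
    ‖(N t x - N t 0) - (N s y - N s 0)‖ ≤ Λ₃ * |t - s| * ‖y‖ + Λ₁ * ‖x - y‖ := by
  have hd := fun r (hr : r ∈ Icc t₀ T) => (hN.contDiff r hr).differentiable (by norm_num)
  have h1 := convex_univ.norm_image_sub_le_of_norm_fderiv_le (f := fun z => N t z - N s z)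
    (C := Λ₃ * |t - s|) (fun z _ => ((hd t ht).sub (hd s hs)) z)
    (fun z _ => by
      rw [fderiv_fun_sub ((hd t ht) z) ((hd s hs) z)]
      exact hN.lipschitz_fderiv z s hs t ht) (mem_univ 0) (mem_univ y)
  rw [sub_zero] at h1
  have e : (N t x - N t 0) - (N s y - N s 0)
      = (N t y - N s y - (N t 0 - N s 0)) + (N t x - N t y) := by abel
  rw [e]
  exact (norm_add_le _ _).trans (add_le_add h1 (hN.norm_sub_le ht x y))

theorem intervalIntegrable_zero (hN : DriftAssumption t₀ T ν Λ₁ Λ₂ Λ₃ N) {s : ℝ}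
    (hs : s ∈ Icc t₀ T) : IntervalIntegrable (fun q => N q 0) volume s T := by
  rw [intervalIntegrable_iff_integrableOn_Icc_of_le hs.2]
  have h := (hN.memLp 0).integrable le_top
  rw [timeMeasure_eq] at h
  exact IntegrableOn.mono_set h (Icc_subset_Icc hs.1 le_rfl)

theorem intervalIntegrable (hN : DriftAssumption t₀ T ν Λ₁ Λ₂ Λ₃ N) {s : ℝ} (hs : s ∈ Icc t₀ T)
    {y : ℝ → Plane} (hy : ContinuousOn y (Icc s T)) :
    IntervalIntegrable (fun q => N q (y q)) volume s T := by
  have hc : ContinuousOn (fun q => N q (y q) - N q 0) (Icc s T) := by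
    intro q hq
    have h1 : ContinuousWithinAt (fun t => Λ₃ * |t - q| * ‖y q‖ + Λ₁ * ‖y t - y q‖) (Icc s T) q := by
      have := hy q hq
      fun_prop
    rw [ContinuousWithinAt, tendsto_iff_norm_sub_tendsto_zero]
    refine squeeze_zero' (Eventually.of_forall fun _ => norm_nonneg _) ?_
      (by simpa using h1.tendsto)
    filter_upwards [self_mem_nhdsWithin] with t ht
    exact hN.norm_increment_le ⟨hs.1.trans hq.1, hq.2⟩ ⟨hs.1.trans ht.1, ht.2⟩ _ _
  have := (ContinuousOn.intervalIntegrable (μ := volume) (by rwa [uIcc_of_le hs.2])).add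
    (hN.intervalIntegrable_zero hs)
  refine this.congr ?_
  exact fun q _ => by simp

theorem exists_isSolution (hN : DriftAssumption t₀ T ν Λ₁ Λ₂ Λ₃ N) {s : ℝ} (hs : s ∈ Icc t₀ T)
    {g : ℝ → Plane} (hg : IntervalIntegrable g volume s T) (x : Plane) :
    ∃ y, IsSolution (fun t x => N t x + g t) s T x y := by
  obtain ⟨y, hy, hye⟩ := exists_integral_eq hs.2 (hN.nonneg₁ (hs.1.trans hs.2))
    (fun t x => N t x + g t)
    (fun t ht x y => by
      rw [add_sub_add_right_eq_sub]
      exact hN.norm_sub_le ⟨hs.1.trans ht.1, ht.2⟩ x y)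
    (fun y hy => (hN.intervalIntegrable hs hy).add hg) x
  refine ⟨y, ?_, (hN.intervalIntegrable hs hy).add hg, ?_⟩ <;> rwa [uIcc_of_le hs.2]

section Estimates

variable {s : ℝ} {g g₁ g₂ y y₁ y₂ : ℝ → Plane} {x x₁ x₂ : Plane} {m : ℝ}

theorem norm_solution_sub_le (hN : DriftAssumption t₀ T ν Λ₁ Λ₂ Λ₃ N) (hs : s ∈ Icc t₀ T)
    (h₁ : IsSolution (fun t x => N t x + g₁ t) s T x₁ y₁)
    (h₂ : IsSolution (fun t x => N t x + g₂ t) s T x₂ y₂)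
    (hm0 : 0 ≤ m) (hm : ∀ᵐ q, q ∈ Icc s T → ‖g₁ q - g₂ q‖ ≤ m) {t : ℝ} (ht : t ∈ Icc s T) :
    ‖y₁ t - y₂ t‖ ≤ (‖x₁ - x₂‖ + m * (T - s)) * Real.exp (Λ₁ * (T - s)) := by
  have hΛ := hN.nonneg₁ (hs.1.trans hs.2)
  have c₁ := h₁.continuousOn
  have c₂ := h₂.continuousOn
  rw [uIcc_of_le hs.2] at c₁ c₂
  have hsI := left_mem_Icc.2 hs.2
  have key := le_mul_exp_of_le_add_integral (f := fun t => ‖y₁ t - y₂ t‖)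
    (c := ‖x₁ - x₂‖ + m * (T - s)) hΛ (c₁.sub c₂).norm (fun t ht => by
      have i₁ := intervalIntegrable_of_Icc hs.2 h₁.integrable hsI ht
      have i₂ := intervalIntegrable_of_Icc hs.2 h₂.integrable hsI ht
      have hcn : IntervalIntegrable (fun q => Λ₁ * ‖y₁ q - y₂ q‖) volume s t :=
        ContinuousOn.intervalIntegrable (by
          rw [uIcc_of_le ht.1]
          exact continuousOn_const.mul ((c₁.sub c₂).norm.mono (Icc_subset_Icc le_rfl ht.2)))
      have hcm : IntervalIntegrable (fun q => Λ₁ * ‖y₁ q - y₂ q‖ + m) volume s t :=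
        hcn.add (by simp)
      rw [h₁.eq_integral t (by rwa [uIcc_of_le hs.2]), h₂.eq_integral t (by rwa [uIcc_of_le hs.2]),
        add_sub_add_comm, ← intervalIntegral.integral_sub i₁ i₂]
      have hb := intervalIntegral.norm_integral_le_of_norm_le (μ := volume) ht.1
        (f := fun q => N q (y₁ q) + g₁ q - (N q (y₂ q) + g₂ q)) (by
          filter_upwards [hm] with q hq hqI
          have hqI' : q ∈ Icc s T := ⟨hqI.1.le, hqI.2.trans ht.2⟩
          rw [add_sub_add_comm]
          exact (norm_add_le _ _).trans (add_le_add
            (hN.norm_sub_le ⟨hs.1.trans hqI'.1, hqI'.2⟩ _ _) (hq hqI'))) hcm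
      refine (norm_add_le _ _).trans ((add_le_add le_rfl hb).trans ?_)
      rw [intervalIntegral.integral_add hcn (by simp), intervalIntegral.integral_const_mul Λ₁,
        intervalIntegral.integral_const, smul_eq_mul]
      have : (t - s) * m ≤ m * (T - s) := by
        rw [mul_comm]
        have := ht.2
        gcongr
      linarith) t ht
  refine key.trans ?_
  have := ht.2
  have := hs.2
  have : 0 ≤ T - s := by linarith
  gcongr

theorem norm_solution_le (hN : DriftAssumption t₀ T ν Λ₁ Λ₂ Λ₃ N) (hs : s ∈ Icc t₀ T)
    (h : IsSolution (fun t x => N t x + g t) s T x y) (hν : 0 ≤ ν)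
    (hm0 : 0 ≤ m) (hm : ∀ᵐ q, q ∈ Icc s T → ‖g q‖ ≤ m) {t : ℝ} (ht : t ∈ Icc s T) :
    ‖y t‖ ≤ (‖x‖ + (ν + m) * (T - s)) * Real.exp (Λ₁ * (T - s)) := by
  -- The zero curve is a trajectory once the forcing cancels `N_t(0)`; comparison with it gives the
  -- growth bound.
  have h0 : IsSolution (fun t x => N t x + (fun q => -N q 0) t) s T 0 (fun _ => 0) :=
    ⟨continuousOn_const, by simp, fun r _ => by simp⟩
  have hb := ae_timeMeasure_iff.1 hN.bound_zero
  have := hN.norm_solution_sub_le hs h h0 (m := ν + m) (by positivity) (by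
    filter_upwards [hm, hb] with q hq hq' hqI
    rw [sub_neg_eq_add, add_comm ν]
    exact (norm_add_le _ _).trans (add_le_add (hq hqI) (hq' ⟨hs.1.trans hqI.1, hqI.2⟩))) ht
  simpa using this

theorem norm_solution_sub_le_mul_abs (hN : DriftAssumption t₀ T ν Λ₁ Λ₂ Λ₃ N)
    (hs : s ∈ Icc t₀ T) (h : IsSolution (fun t x => N t x + g t) s T x y) {R : ℝ}
    (hR : ∀ t ∈ Icc s T, ‖y t‖ ≤ R) (hm : ∀ᵐ q, q ∈ Icc s T → ‖g q‖ ≤ m)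
    {t t' : ℝ} (ht : t ∈ Icc s T) (ht' : t' ∈ Icc s T) :
    ‖y t' - y t‖ ≤ (Λ₁ * R + ν + m) * |t' - t| := by
  have hΛ := hN.nonneg₁ (hs.1.trans hs.2)
  rw [h.sub_eq hs.2 ht ht']
  refine intervalIntegral.norm_integral_le_of_norm_le_const_ae ?_
  filter_upwards [hm, ae_timeMeasure_iff.1 hN.bound_zero] with q hq hq0 hqI
  have hqs : q ∈ Icc s T := uIcc_subset_Icc ht ht' (uIoc_subset_uIcc hqI)
  have hqt : q ∈ Icc t₀ T := ⟨hs.1.trans hqs.1, hqs.2⟩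
  have e : N q (y q) + g q = (N q (y q) - N q 0) + N q 0 + g q := by abel
  rw [e]
  refine (norm_add_le _ _).trans (add_le_add ((norm_add_le _ _).trans
    (add_le_add ((hN.norm_sub_le hqt _ _).trans ?_) (hq0 hqt))) (hq hqs))
  rw [sub_zero]
  gcongr
  exact hR q hqs

/-- First order expansion of the final state in the initial value and the forcing term. -/
theorem norm_solution_sub_linear_le (hN : DriftAssumption t₀ T ν Λ₁ Λ₂ Λ₃ N) (hs : s ∈ Icc t₀ T)
    (hg₁ : IntervalIntegrable g₁ volume s T) (hg₂ : IntervalIntegrable g₂ volume s T)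
    (h₁ : IsSolution (fun t x => N t x + g₁ t) s T x₁ y₁)
    (h₂ : IsSolution (fun t x => N t x + g₂ t) s T x₂ y₂)
    (hm0 : 0 ≤ m) (hm : ∀ᵐ q, q ∈ Icc s T → ‖g₁ q - g₂ q‖ ≤ m) {P : ℝ → Plane →L[ℝ] Plane}
    (hP : IsResolvent (fun q => fderiv ℝ (N q) (y₂ q)) s T P) :
    ‖y₁ T - y₂ T - P s (x₁ - x₂) - ∫ q in s..T, P q (g₁ q - g₂ q)‖ ≤
      Real.exp (Λ₁ * (T - t₀)) * (Λ₂ * ((1 + (T - t₀)) * Real.exp (Λ₁ * (T - t₀))) ^ 2)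
        * (T - t₀) * (‖x₁ - x₂‖ + m) ^ 2 := by
  have hΛ := hN.nonneg₁ (hs.1.trans hs.2)
  have hΛ₂ := hN.nonneg₂ (hs.1.trans hs.2)
  have c₁ := h₁.continuousOn
  have c₂ := h₂.continuousOn
  rw [uIcc_of_le hs.2] at c₁ c₂
  have hsI := left_mem_Icc.2 hs.2
  have hTI := right_mem_Icc.2 hs.2
  have hsub : ∀ q ∈ Icc s T, q ∈ Icc t₀ T := fun q hq => ⟨hs.1.trans hq.1, hq.2⟩
  have hTs : 0 ≤ T - s := sub_nonneg.2 hs.2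
  have hst : T - s ≤ T - t₀ := by linarith [hs.1]
  have hTt : 0 ≤ T - t₀ := hTs.trans hst
  set E := Real.exp (Λ₁ * (T - t₀)) with hE
  have hEE : Real.exp (Λ₁ * (T - s)) ≤ E := by rw [hE]; gcongr
  -- A bound for the distance of the two solutions that is independent of the starting time `s`.
  set D := (1 + (T - t₀)) * E * (‖x₁ - x₂‖ + m) with hD
  have hD0 : 0 ≤ D := by positivity
  have hd : ∀ t ∈ Icc s T, ‖y₁ t - y₂ t‖ ≤ D := by
    intro t ht
    refine (hN.norm_solution_sub_le hs h₁ h₂ hm0 hm ht).trans ?_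
    calc (‖x₁ - x₂‖ + m * (T - s)) * Real.exp (Λ₁ * (T - s))
        ≤ ((1 + (T - t₀)) * (‖x₁ - x₂‖ + m)) * E := by
          gcongr
          have h1 : m * (T - s) ≤ m * (T - t₀) := by gcongr
          have h2 : 0 ≤ (T - t₀) * ‖x₁ - x₂‖ := by positivity
          linarith
      _ = D := by rw [hD]; ring
  set A : ℝ → Plane →L[ℝ] Plane := fun q => fderiv ℝ (N q) (y₂ q) with hAdef
  have hA : ContinuousOn A (Icc s T) := hN.continuousOn_fderiv hs.1 c₂
  have hAK : ∀ t ∈ Icc s T, ‖A t‖ ≤ Λ₁ := fun t ht => hN.bound_fderiv t (hsub t ht) _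
  -- The difference `y₁ - y₂` solves the linearised equation with forcing `ρ + (g₁ - g₂)`. Only `ρ`,
  -- which is quadratic in the data, survives in the remainder.
  set ρ : ℝ → Plane := fun q => N q (y₁ q) - N q (y₂ q) - A q (y₁ q - y₂ q) with hρ
  have hρb : ∀ q ∈ Icc s T, ‖ρ q‖ ≤ Λ₂ * D ^ 2 := by
    intro q hq
    refine (hN.norm_remainder_le (hsub q hq) _ _).trans ?_
    gcongr
    exact hd q hq
  have hρi : IntervalIntegrable ρ volume s T := by
    refine ((hN.intervalIntegrable hs c₁).sub (hN.intervalIntegrable hs c₂)).sub ?_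
    exact ContinuousOn.intervalIntegrable (by
      rw [uIcc_of_le hs.2]; exact hA.clm_apply (c₁.sub c₂))
  have hgi := hg₁.sub hg₂
  have key := hP.apply_eq (z := fun q => y₁ q - y₂ q) (b := fun q => ρ q + (g₁ q - g₂ q))
    (m := Λ₂ * D ^ 2 + m) hA hΛ hAK hs.2 (c₁.sub c₂) (hρi.add hgi)
    (by
      filter_upwards [hm] with q hq hqI
      exact (norm_add_le _ _).trans (add_le_add (hρb q hqI) (hq hqI)))
    (by
      intro t ht
      have i₁ := intervalIntegrable_of_Icc hs.2 h₁.integrable hsI ht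
      have i₂ := intervalIntegrable_of_Icc hs.2 h₂.integrable hsI ht
      rw [h₁.eq_integral t (by rwa [uIcc_of_le hs.2]), h₂.eq_integral t (by rwa [uIcc_of_le hs.2]),
        h₁.apply_left, h₂.apply_left, add_sub_add_comm, ← intervalIntegral.integral_sub i₁ i₂]
      congr 1
      refine intervalIntegral.integral_congr fun q _ => ?_
      simp only [hρ]
      abel)
  have i₁ := intervalIntegrable_clm_apply hs.2 hP.continuousOn hρi
  have i₂ := intervalIntegrable_clm_apply hs.2 hP.continuousOn hgi
  have e : y₁ T - y₂ T - P s (x₁ - x₂) - ∫ q in s..T, P q (g₁ q - g₂ q)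
      = ∫ q in s..T, P q (ρ q) := by
    simp only [map_add] at key
    rw [intervalIntegral.integral_add i₁ i₂, h₁.apply_left, h₂.apply_left] at key
    rw [key]
    abel
  rw [e]
  have hfin := intervalIntegral.norm_integral_le_of_norm_le_const (a := s) (b := T)
    (C := E * (Λ₂ * D ^ 2)) (f := fun q => P q (ρ q)) (fun q hq => by
      rw [uIoc_of_le hs.2] at hq
      have hq' : q ∈ Icc s T := ⟨hq.1.le, hq.2⟩
      refine (ContinuousLinearMap.le_opNorm _ _).trans ?_
      gcongr
      · exact (hP.norm_le' hΛ hAK hq').trans hEE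
      · exact hρb q hq')
  refine hfin.trans ?_
  rw [abs_of_nonneg hTs]
  calc E * (Λ₂ * D ^ 2) * (T - s) ≤ E * (Λ₂ * D ^ 2) * (T - t₀) := by gcongr
    _ = _ := by rw [hD]; ring

end Estimates

end DriftAssumption

/-! ### Derivative of the flow and the variation of constants formula -/

theorem intervalIntegrable_zero_fun {s T : ℝ} : IntervalIntegrable (0 : ℝ → Plane) volume s T :=
  intervalIntegrable_const (c := (0 : Plane))

theorem hasFDerivAt_of_norm_sub_le_mul_sq {E F : Type*} [NormedAddCommGroup E] [NormedSpace ℝ E]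
    [NormedAddCommGroup F] [NormedSpace ℝ F] {f : E → F} {L : E →L[ℝ] F} {x : E} {C : ℝ}
    (h : ∀ y, ‖f y - f x - L (y - x)‖ ≤ C * ‖y - x‖ ^ 2) : HasFDerivAt f L x := by
  rw [hasFDerivAt_iff_isLittleO, Asymptotics.isLittleO_iff]
  intro c hc
  have hcont : Continuous fun y : E => C * ‖y - x‖ := by fun_prop
  have ht : Tendsto (fun y => C * ‖y - x‖) (𝓝 x) (𝓝 0) := by simpa using hcont.tendsto x
  filter_upwards [ht.eventually (gt_mem_nhds hc)] with y hy
  refine (h y).trans ?_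
  rw [sq, ← mul_assoc]
  gcongr

namespace DriftAssumption

variable {t₀ T ν Λ₁ Λ₂ Λ₃ : ℝ} {N : ℝ → Plane → Plane}

theorem nonneg₀ (hN : DriftAssumption t₀ T ν Λ₁ Λ₂ Λ₃ N) (hT : t₀ < T) : 0 ≤ ν := by
  have : NeBot (ae (timeMeasure t₀ T)) := by
    rw [ae_neBot, Ne, Measure.restrict_eq_zero]
    simpa using hT
  obtain ⟨t, ht⟩ := hN.bound_zero.exists
  exact (norm_nonneg _).trans ht

theorem isSolution_solution (hN : DriftAssumption t₀ T ν Λ₁ Λ₂ Λ₃ N) {s : ℝ}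
    (hs : s ∈ Icc t₀ T) (x : Plane) :
    IsSolution (fun t x => N t x + (0 : ℝ → Plane) t) s T x (solution N s T x) := by
  rw [isSolution_add_zero]
  obtain ⟨y, hy⟩ := hN.exists_isSolution hs (g := 0) intervalIntegrable_zero_fun x
  exact solution_spec ⟨y, isSolution_add_zero.1 hy⟩

theorem exists_isResolvent (hN : DriftAssumption t₀ T ν Λ₁ Λ₂ Λ₃ N) {s : ℝ}
    (hs : s ∈ Icc t₀ T) {y : ℝ → Plane} (hy : ContinuousOn y (Icc s T)) :
    ∃ P, IsResolvent (fun q => fderiv ℝ (N q) (y q)) s T P :=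
  PlanarControl.exists_isResolvent hs.2 (hN.nonneg₁ (hs.1.trans hs.2))
    (hN.continuousOn_fderiv hs.1 hy) fun t ht => hN.bound_fderiv t ⟨hs.1.trans ht.1, ht.2⟩ _

theorem hasFDerivAt_flow (hN : DriftAssumption t₀ T ν Λ₁ Λ₂ Λ₃ N) {s : ℝ} (hs : s ∈ Icc t₀ T)
    {x : Plane} {P : ℝ → Plane →L[ℝ] Plane}
    (hP : IsResolvent (fun q => fderiv ℝ (N q) (solution N s T x q)) s T P) :
    HasFDerivAt (flow N s T) (P s) x := by
  refine hasFDerivAt_of_norm_sub_le_mul_sq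
    (C := Real.exp (Λ₁ * (T - t₀)) * (Λ₂ * ((1 + (T - t₀)) * Real.exp (Λ₁ * (T - t₀))) ^ 2)
      * (T - t₀)) fun x' => ?_
  have := hN.norm_solution_sub_linear_le hs (g₁ := 0) (g₂ := 0)
    intervalIntegrable_zero_fun intervalIntegrable_zero_fun
    (hN.isSolution_solution hs x') (hN.isSolution_solution hs x) le_rfl
    (ae_of_all _ fun q _ => by simp) hP
  simpa [flow] using this

/-- The nonlinear variation of constants formula of Alekseev and Gröbner. -/
theorem variation_of_constants (hN : DriftAssumption t₀ T ν Λ₁ Λ₂ Λ₃ N) (hT : t₀ < T)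
    {g X : ℝ → Plane} {x₀ : Plane} {m : ℝ} (hg : IntervalIntegrable g volume t₀ T) (hm0 : 0 ≤ m)
    (hm : ∀ᵐ q, q ∈ Icc t₀ T → ‖g q‖ ≤ m)
    (hX : IsSolution (fun t x => N t x + g t) t₀ T x₀ X) :
    X T = flow N t₀ T x₀ + ∫ t in t₀..T, fderiv ℝ (flow N t T) (X t) (g t) := by
  have hI₀ : t₀ ∈ Icc t₀ T := left_mem_Icc.2 hT.le
  have hIT : T ∈ Icc t₀ T := right_mem_Icc.2 hT.le
  have hΛ := hN.nonneg₁ hT.le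
  have hΛ₂ := hN.nonneg₂ hT.le
  have hν := hN.nonneg₀ hT
  have hTt : 0 ≤ T - t₀ := by linarith
  have cX := hX.continuousOn
  rw [uIcc_of_le hT.le] at cX
  obtain ⟨R₀, hR₀⟩ := isCompact_Icc.exists_bound_of_continuousOn cX
  have hR₀0 : 0 ≤ R₀ := (norm_nonneg _).trans (hR₀ t₀ hI₀)
  set E := Real.exp (Λ₁ * (T - t₀)) with hE
  have hEs : ∀ s ∈ Icc t₀ T, Real.exp (Λ₁ * (T - s)) ≤ E := fun s hs => by
    rw [hE]; gcongr; exact hs.1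
  -- Follow the forced trajectory up to time `q`, then the free flow. The end point `Y q T` moves
  -- from `Φ_{t₀,T}(x₀)` at `q = t₀` to `X T` at `q = T`.
  set Y : ℝ → ℝ → Plane := fun q => solution N q T (X q) with hYdef
  have hY : ∀ q ∈ Icc t₀ T, IsSolution (fun t x => N t x + (0 : ℝ → Plane) t) q T (X q) (Y q) :=
    fun q hq => hN.isSolution_solution hq _
  have cY : ∀ q ∈ Icc t₀ T, ContinuousOn (Y q) (Icc q T) := fun q hq => by
    have := (hY q hq).continuousOn
    rwa [uIcc_of_le hq.2] at this
  have hres : ∀ q ∈ Icc t₀ T, ∃ P, IsResolvent (fun r => fderiv ℝ (N r) (Y q r)) q T P :=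
    fun q hq => hN.exists_isResolvent hq (cY q hq)
  choose! P hP using hres
  have hM : ∀ q ∈ Icc t₀ T, fderiv ℝ (flow N q T) (X q) = P q q := fun q hq =>
    (hN.hasFDerivAt_flow hq (hP q hq)).fderiv
  have hsub : ∀ q ∈ Icc t₀ T, ∀ t ∈ Icc q T, t ∈ Icc t₀ T := fun q hq t ht =>
    ⟨hq.1.trans ht.1, ht.2⟩
  have cA : ∀ q ∈ Icc t₀ T, ContinuousOn (fun r => fderiv ℝ (N r) (Y q r)) (Icc q T) :=
    fun q hq => hN.continuousOn_fderiv hq.1 (cY q hq)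
  have bA : ∀ q ∈ Icc t₀ T, ∀ t ∈ Icc q T, ‖fderiv ℝ (N t) (Y q t)‖ ≤ Λ₁ :=
    fun q hq t ht => hN.bound_fderiv t (hsub q hq t ht) _
  have hPE : ∀ q ∈ Icc t₀ T, ∀ t ∈ Icc q T, ‖P q t‖ ≤ E := fun q hq t ht =>
    ((hP q hq).norm_le' hΛ (bA q hq) ht).trans (hEs q hq)
  set R₁ := (R₀ + ν * (T - t₀)) * E with hR₁
  have hR₁0 : 0 ≤ R₁ := by positivity
  have hYR : ∀ q ∈ Icc t₀ T, ∀ t ∈ Icc q T, ‖Y q t‖ ≤ R₁ := by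
    intro q hq t ht
    refine (hN.norm_solution_le hq (hY q hq) hν le_rfl (ae_of_all _ fun q _ => by simp) ht).trans ?_
    have := hEs q hq
    have := hR₀ q hq
    have := hq.1
    have : 0 ≤ T - q := by linarith [hq.2]
    rw [add_zero, hR₁]
    gcongr
  set L₀ := Λ₁ * R₀ + ν + m
  set L₁ := Λ₁ * R₁ + ν + 0
  set L := L₀ + L₁ with hL
  have hL0 : 0 ≤ L := by positivity
  have hd : ∀ q ∈ Icc t₀ T, ∀ t ∈ Icc q T, ‖Y q t - X t‖ ≤ L * (t - q) := by
    intro q hq t ht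
    have hqI := left_mem_Icc.2 hq.2
    have h1 := hN.norm_solution_sub_le_mul_abs hq (hY q hq) (hYR q hq) (m := 0)
      (ae_of_all _ fun q _ => by simp) hqI ht
    have h2 := hN.norm_solution_sub_le_mul_abs hI₀ hX hR₀ hm hq (hsub q hq t ht)
    rw [abs_of_nonneg (sub_nonneg.2 ht.1)] at h1 h2
    have e : Y q t - X t = (Y q t - Y q q) - (X t - X q) := by
      rw [(hY q hq).apply_left]; abel
    rw [e]
    refine (_root_.norm_sub_le _ _).trans ((add_le_add h1 h2).trans (le_of_eq ?_))
    rw [hL]; ring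
  -- A Lipschitz constant of `q ↦ DΦ_{q,T}(X q)`: the first term comes from changing the trajectory
  -- of linearisation, the second from moving the initial time.
  set LM := E * (Λ₂ * (L * E)) * (T - t₀) * E + E * Λ₁ with hLM
  have hLM0 : 0 ≤ LM := by positivity
  have hMLip : ∀ q ∈ Icc t₀ T, ∀ q' ∈ Icc t₀ T, q ≤ q' →
      ‖P q' q' - P q q‖ ≤ LM * (q' - q) := by
    intro q hq q' hq' hqq
    have hqI := left_mem_Icc.2 hq.2
    have hqI' := left_mem_Icc.2 hq'.2
    have hq'q : q' ∈ Icc q T := ⟨hqq, hq'.2⟩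
    have hqq0 : 0 ≤ q' - q := sub_nonneg.2 hqq
    have hsubq : Icc q' T ⊆ Icc q T := Icc_subset_Icc hqq le_rfl
    have h1 : ∀ t ∈ Icc q' T, ‖Y q' t - Y q t‖ ≤ L * (q' - q) * E := by
      intro t ht
      refine (hN.norm_solution_sub_le hq' (hY q' hq') ((hY q hq).mono hqq hq'.2) le_rfl
        (ae_of_all _ fun q _ => by simp) ht).trans ?_
      rw [zero_mul, add_zero, norm_sub_rev]
      have := hd q hq q' hq'q
      have := hEs q' hq'
      gcongr
    have h2 := (hP q' hq').norm_sub_le_of_norm_sub_le ((hP q hq).mono hqq) (cA q' hq')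
      ((cA q hq).mono hsubq) hΛ (bA q' hq') (fun t ht => bA q hq t (hsubq ht))
      (ε := Λ₂ * (L * (q' - q) * E)) (fun t ht => by
        refine (hN.norm_fderiv_sub_le (hsub q' hq' t ht) _ _).trans ?_
        gcongr
        exact h1 t ht) hqI'
    have h3 := (hP q hq).norm_sub_le_mul_abs (cA q hq) hΛ (bA q hq) hqI hq'q
    rw [abs_of_nonneg hqq0] at h3
    have e : P q' q' - P q q = (P q' q' - P q q') + (P q q' - P q q) := by abel
    rw [e]
    refine (norm_add_le _ _).trans ((add_le_add h2 h3).trans ?_)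
    have := hEs q hq
    have := hEs q' hq'
    have := hq'.1
    have : 0 ≤ T - q' := by linarith [hq'.2]
    calc _ ≤ E * (Λ₂ * (L * (q' - q) * E)) * (T - t₀) * E + E * Λ₁ * (q' - q) := by gcongr
      _ = _ := by rw [hLM]; ring
  have cM : ContinuousOn (fun q => P q q) (Icc t₀ T) := by
    intro q hq
    have h1 : ContinuousWithinAt (fun t => LM * |t - q|) (Icc t₀ T) q := by fun_prop
    rw [ContinuousWithinAt, tendsto_iff_norm_sub_tendsto_zero]
    refine squeeze_zero' (Eventually.of_forall fun _ => norm_nonneg _) ?_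
      (by simpa using h1.tendsto)
    filter_upwards [self_mem_nhdsWithin] with t ht
    rcases le_total q t with h | h
    · rw [abs_of_nonneg (sub_nonneg.2 h)]
      exact hMLip q hq t ht h
    · rw [norm_sub_rev, abs_sub_comm, abs_of_nonneg (sub_nonneg.2 h)]
      exact hMLip t ht q hq h
  have hMg : IntervalIntegrable (fun q => P q q (g q)) volume t₀ T :=
    intervalIntegrable_clm_apply hT.le cM hg
  set C := E * (Λ₂ * ((1 + (T - t₀)) * E) ^ 2) * (T - t₀) with hC
  have hC0 : 0 ≤ C := by positivity
  have key := eq_of_norm_sub_le_mul_sq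
    (e := fun q => Y q T - ∫ t in t₀..q, P t t (g t))
    (C := C * L ^ 2 + E * (Λ₁ * L) + LM * m) hT.le (by
      intro q hq q' hq' hqq
      have hq'q : q' ∈ Icc q T := ⟨hqq, hq'.2⟩
      have hqI := left_mem_Icc.2 hq.2
      have hqI' := left_mem_Icc.2 hq'.2
      have hqq0 : 0 ≤ q' - q := sub_nonneg.2 hqq
      have h1 := hN.norm_solution_sub_linear_le hq' (g₁ := 0) (g₂ := 0)
        intervalIntegrable_zero_fun intervalIntegrable_zero_fun
        ((hY q hq).mono hqq hq'.2) (hY q' hq') le_rfl (ae_of_all _ fun q _ => by simp) (hP q' hq')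
      simp only [Pi.zero_apply, sub_self, map_zero, intervalIntegral.integral_zero, sub_zero,
        add_zero] at h1
      have h1' : ‖Y q T - Y q' T - P q' q' (Y q q' - X q')‖ ≤ C * (L * (q' - q)) ^ 2 := by
        refine h1.trans ?_
        have := hd q hq q' hq'q
        gcongr
      have iX := intervalIntegrable_of_Icc hT.le (hN.intervalIntegrable hI₀ cX) hq hq'
      have iY := intervalIntegrable_of_Icc hq.2 (hN.intervalIntegrable hq (cY q hq)) hqI hq'q
      have ig := intervalIntegrable_of_Icc hT.le hg hq hq'
      have h2 : X q' - Y q q' = (∫ t in q..q', (N t (X t) - N t (Y q t))) + ∫ t in q..q', g t := by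
        have e1 := hX.sub_eq hT.le hq hq'
        have e2 := (hY q hq).sub_eq hq.2 hqI hq'q
        rw [(hY q hq).apply_left] at e2
        rw [← sub_sub_sub_cancel_right _ _ (X q), e1, e2, intervalIntegral.integral_add iX ig,
          intervalIntegral.integral_sub iX iY]
        simp only [Pi.zero_apply, add_zero]
        abel
      have h3 : ‖∫ t in q..q', (N t (X t) - N t (Y q t))‖ ≤ Λ₁ * (L * (q' - q)) * (q' - q) := by
        have := intervalIntegral.norm_integral_le_of_norm_le_const (a := q) (b := q')
          (C := Λ₁ * (L * (q' - q))) (f := fun t => N t (X t) - N t (Y q t)) (fun t ht => by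
            rw [uIoc_of_le hqq] at ht
            have htI : t ∈ Icc q T := ⟨ht.1.le, ht.2.trans hq'.2⟩
            refine (hN.norm_sub_le (hsub q hq t htI) _ _).trans ?_
            gcongr
            rw [norm_sub_rev]
            refine (hd q hq t htI).trans ?_
            gcongr
            exact ht.2)
        rwa [abs_of_nonneg hqq0] at this
      have i1 := intervalIntegrable_of_Icc hT.le hMg hq hq'
      have i2 : IntervalIntegrable (fun t => P q' q' (g t)) volume q q' :=
        ⟨(P q' q').integrable_comp ig.1, (P q' q').integrable_comp ig.2⟩
      have h4 : ‖P q' q' (∫ t in q..q', g t) - ∫ t in q..q', P t t (g t)‖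
          ≤ LM * (q' - q) * m * (q' - q) := by
        rw [← (P q' q').intervalIntegral_comp_comm ig, ← intervalIntegral.integral_sub i2 i1]
        have := intervalIntegral.norm_integral_le_of_norm_le_const_ae (a := q) (b := q')
          (C := LM * (q' - q) * m) (f := fun t => P q' q' (g t) - P t t (g t)) (by
            filter_upwards [hm] with t ht htI
            rw [uIoc_of_le hqq] at htI
            have htt : t ∈ Icc t₀ T := ⟨hq.1.trans htI.1.le, htI.2.trans hq'.2⟩
            rw [← sub_apply]
            refine (ContinuousLinearMap.le_opNorm _ _).trans ?_
            gcongr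
            · refine (hMLip t htt q' hq' htI.2).trans ?_
              gcongr
              exact htI.1.le
            · exact ht htt)
        rwa [abs_of_nonneg hqq0] at this
      have i0 := intervalIntegrable_of_Icc hT.le hMg hI₀ hq
      -- The three errors are that of linearising the flow at time `q'`, that of the drift along two
      -- nearby curves, and that of freezing `DΦ` at `q'`. Each is quadratic in `q' - q`.
      have e : Y q' T - (∫ t in t₀..q', P t t (g t)) - (Y q T - ∫ t in t₀..q, P t t (g t))
          = -(Y q T - Y q' T - P q' q' (Y q q' - X q'))
            + P q' q' (∫ t in q..q', (N t (X t) - N t (Y q t)))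
            + (P q' q' (∫ t in q..q', g t) - ∫ t in q..q', P t t (g t)) := by
        rw [← intervalIntegral.integral_add_adjacent_intervals i0 i1, ← neg_sub (X q'), h2]
        simp only [map_neg, map_add]
        abel
      rw [e]
      have h5 : ‖P q' q' (∫ t in q..q', (N t (X t) - N t (Y q t)))‖
          ≤ E * (Λ₁ * (L * (q' - q)) * (q' - q)) := by
        refine (ContinuousLinearMap.le_opNorm _ _).trans ?_
        have := hPE q' hq' q' hqI'
        gcongr
      refine (norm_add₃_le).trans ?_
      rw [norm_neg]
      refine (add_le_add (add_le_add h1' h5) h4).trans (le_of_eq ?_)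
      ring)
  simp only [intervalIntegral.integral_same, sub_zero] at key
  have e1 : Y T T = X T := (hY T hIT).apply_left
  have e2 : Y t₀ T = flow N t₀ T x₀ := by
    simp only [hYdef, flow, hX.apply_left]
  rw [e1, e2, sub_eq_iff_eq_add] at key
  rw [key]
  congr 1
  refine intervalIntegral.integral_congr fun t ht => ?_
  rw [uIcc_of_le hT.le] at ht
  simp only [hM t ht]

end DriftAssumption

/-! ### The end-point map and its differential -/

theorem ae_norm_control_le {t₀ T : ℝ} (u : Control t₀ T) :
    ∀ᵐ q, q ∈ Icc t₀ T → ‖u q‖ ≤ ‖u‖ := by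
  refine ae_timeMeasure_iff.1 ?_
  filter_upwards [ae_le_eLpNormEssSup (f := u) (μ := timeMeasure t₀ T)] with q hq
  rw [Lp.norm_def, eLpNorm_exponent_top, ← toReal_enorm]
  refine ENNReal.toReal_mono ?_ hq
  rw [← eLpNorm_exponent_top]
  exact Lp.eLpNorm_ne_top u

/-- The functional `w ↦ ∫ w ψ` on `L^p` for continuous `ψ`. -/
theorem exists_clm_integral_smul {t₀ T : ℝ} (hT : t₀ ≤ T) (p q : ℝ≥0∞) [Fact (1 ≤ p)]
    [Fact (1 ≤ q)] [ENNReal.HolderConjugate p q] {ψ : ℝ → Plane}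
    (hψ : ContinuousOn ψ (Icc t₀ T)) :
    ∃ D : Lp ℝ p (timeMeasure t₀ T) →L[ℝ] Plane,
      ∀ w : Lp ℝ p (timeMeasure t₀ T), D w = ∫ t in t₀..T, w t • ψ t := by
  have hmem : MemLp ψ q (timeMeasure t₀ T) := by
    obtain ⟨C, hC⟩ := isCompact_Icc.exists_bound_of_continuousOn hψ
    refine MemLp.of_bound ?_ C (ae_timeMeasure_iff.2 (ae_of_all _ hC))
    rw [timeMeasure_eq]
    exact hψ.aestronglyMeasurable measurableSet_Icc
  refine ⟨((ContinuousLinearMap.lsmul ℝ ℝ : ℝ →L[ℝ] Plane →L[ℝ] Plane).lpPairing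
    (timeMeasure t₀ T) p q).flip hmem.toLp, fun w => ?_⟩
  rw [ContinuousLinearMap.flip_apply, ContinuousLinearMap.lpPairing_eq_integral,
    intervalIntegral.integral_of_le hT, ← integral_Icc_eq_integral_Ioc, ← timeMeasure_eq]
  refine integral_congr_ae ?_
  filter_upwards [hmem.coeFn_toLp] with t ht
  rw [ht, ContinuousLinearMap.lsmul_apply]

theorem InputAssumption.continuousOn {t₀ T b₀ b₁ b₂ : ℝ} {B : ℝ → Plane}
    (hB : InputAssumption t₀ T b₀ b₁ b₂ B) : ContinuousOn B (Icc t₀ T) :=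
  hB.differentiableOn.continuousOn

theorem InputAssumption.nonneg₀ {t₀ T b₀ b₁ b₂ : ℝ} {B : ℝ → Plane}
    (hB : InputAssumption t₀ T b₀ b₁ b₂ B) (hT : t₀ ≤ T) : 0 ≤ b₀ :=
  (norm_nonneg _).trans (hB.bound T (right_mem_Icc.2 hT))

section

variable {t₀ T ν Λ₁ Λ₂ Λ₃ b₀ b₁ b₂ : ℝ} {N : ℝ → Plane → Plane} {B : ℝ → Plane}

theorem intervalIntegrable_control_smul {ψ : ℝ → Plane} (hψ : ContinuousOn ψ (Icc t₀ T))
    (hT : t₀ ≤ T) (u : Control t₀ T) :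
    IntervalIntegrable (fun t => u t • ψ t) volume t₀ T := by
  obtain ⟨C, hC⟩ := isCompact_Icc.exists_bound_of_continuousOn hψ
  rw [intervalIntegrable_iff_integrableOn_Icc_of_le hT, IntegrableOn, ← timeMeasure_eq]
  have hm : AEStronglyMeasurable ψ (timeMeasure t₀ T) := by
    rw [timeMeasure_eq]; exact hψ.aestronglyMeasurable measurableSet_Icc
  refine Integrable.mono' (integrable_const (‖u‖ * C))
    ((Lp.aestronglyMeasurable u).smul hm) (ae_timeMeasure_iff.2 ?_)
  filter_upwards [ae_norm_control_le u] with q hq hqI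
  rw [norm_smul]
  exact mul_le_mul (hq hqI) (hC q hqI) (norm_nonneg _) (norm_nonneg _)

theorem InputAssumption.ae_norm_smul_le (hB : InputAssumption t₀ T b₀ b₁ b₂ B)
    (u : Control t₀ T) : ∀ᵐ q, q ∈ Icc t₀ T → ‖u q • B q‖ ≤ ‖u‖ * b₀ := by
  filter_upwards [ae_norm_control_le u] with q hq hqI
  rw [norm_smul]
  exact mul_le_mul (hq hqI) (hB.bound q hqI) (norm_nonneg _) (norm_nonneg _)

theorem isSolution_trajectory (hN : DriftAssumption t₀ T ν Λ₁ Λ₂ Λ₃ N)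
    (hB : InputAssumption t₀ T b₀ b₁ b₂ B) (hT : t₀ ≤ T) (x₀ : Plane) (u : Control t₀ T) :
    IsSolution (fun t x => N t x + (fun q => u q • B q) t) t₀ T x₀
      (trajectory N B t₀ T x₀ u) :=
  solution_spec (hN.exists_isSolution (left_mem_Icc.2 hT)
    (intervalIntegrable_control_smul hB.continuousOn hT u) x₀)

/-- The feasible map is the end-point map. -/
theorem feasibleMap_eq (hN : DriftAssumption t₀ T ν Λ₁ Λ₂ Λ₃ N)
    (hB : InputAssumption t₀ T b₀ b₁ b₂ B) (hT : t₀ < T) (x₀ x₁ : Plane) (u : Control t₀ T) :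
    feasibleMap N B t₀ T T x₀ x₁ u = trajectory N B t₀ T x₀ u T - x₁ := by
  have h₀ := hB.nonneg₀ hT.le
  have h := hN.variation_of_constants hT
    (intervalIntegrable_control_smul hB.continuousOn hT.le u) (by positivity)
    (hB.ae_norm_smul_le u) (isSolution_trajectory hN hB hT.le x₀ u)
  have h1 : flow N T T x₁ = x₁ :=
    (hN.isSolution_solution (right_mem_Icc.2 hT.le) x₁).apply_left
  rw [feasibleMap, h1, h, inputMap]
  simp only [map_smul]
  abel

/-- The Fréchet derivative of the feasible map. -/
theorem hasFDerivAt_feasibleMap (hN : DriftAssumption t₀ T ν Λ₁ Λ₂ Λ₃ N)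
    (hB : InputAssumption t₀ T b₀ b₁ b₂ B) (hT : t₀ < T) (x₀ x₁ : Plane) (u : Control t₀ T)
    {P : ℝ → Plane →L[ℝ] Plane}
    (hP : IsResolvent (fun q => fderiv ℝ (N q) (trajectory N B t₀ T x₀ u q)) t₀ T P)
    {D : Control t₀ T →L[ℝ] Plane}
    (hD : ∀ v : Control t₀ T, D v = ∫ t in t₀..T, v t • P t (B t)) :
    HasFDerivAt (feasibleMap N B t₀ T T x₀ x₁) D u := by
  have h₀ := hB.nonneg₀ hT.le
  refine hasFDerivAt_of_norm_sub_le_mul_sq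
    (C := Real.exp (Λ₁ * (T - t₀)) * (Λ₂ * ((1 + (T - t₀)) * Real.exp (Λ₁ * (T - t₀))) ^ 2)
      * (T - t₀) * b₀ ^ 2) fun v => ?_
  have hae : ∀ᵐ q, q ∈ Icc t₀ T → (v - u : Control t₀ T) q = v q - u q :=
    ae_timeMeasure_iff.1 (Lp.coeFn_sub v u)
  have key := hN.norm_solution_sub_linear_le (left_mem_Icc.2 hT.le)
    (intervalIntegrable_control_smul hB.continuousOn hT.le v)
    (intervalIntegrable_control_smul hB.continuousOn hT.le u)
    (isSolution_trajectory hN hB hT.le x₀ v) (isSolution_trajectory hN hB hT.le x₀ u)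
    (m := ‖v - u‖ * b₀) (by positivity) (by
      filter_upwards [hB.ae_norm_smul_le (v - u), hae] with q hq hq' hqI
      rw [← sub_smul, ← hq' hqI]
      exact hq hqI) hP
  have e : ∫ q in t₀..T, P q (v q • B q - u q • B q) = D (v - u) := by
    rw [hD]
    refine intervalIntegral.integral_congr_ae ?_
    filter_upwards [hae] with q hq hqI
    rw [uIoc_of_le hT.le] at hqI
    rw [hq ⟨hqI.1.le, hqI.2⟩, ← sub_smul, map_smul]
  rw [sub_self, map_zero, sub_zero, norm_zero, zero_add, e] at key
  rw [feasibleMap_eq hN hB hT, feasibleMap_eq hN hB hT, sub_sub_sub_cancel_right]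
  refine key.trans (le_of_eq ?_)
  ring

/-- The differential of the feasible map exists and is represented by the resolvent. -/
theorem isDifferential_differential (hN : DriftAssumption t₀ T ν Λ₁ Λ₂ Λ₃ N)
    (hB : InputAssumption t₀ T b₀ b₁ b₂ B) (hT : t₀ < T) (x₀ x₁ : Plane) (u : Control t₀ T)
    {P : ℝ → Plane →L[ℝ] Plane}
    (hP : IsResolvent (fun q => fderiv ℝ (N q) (trajectory N B t₀ T x₀ u q)) t₀ T P)
    (v : Control t₀ T) (w : ControlL2 t₀ T) (hw : w =ᵐ[timeMeasure t₀ T] v) :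
    differential (feasibleMap N B t₀ T T x₀ x₁) u w = ∫ t in t₀..T, v t • P t (B t) := by
  have hψ : ContinuousOn (fun t => P t (B t)) (Icc t₀ T) :=
    hP.continuousOn.clm_apply hB.continuousOn
  -- The same integral formula defines the Fréchet derivative on `L^∞` and its extension to `L²`.
  obtain ⟨D, hD⟩ := exists_clm_integral_smul hT.le ∞ 1 hψ
  obtain ⟨D₂, hD₂⟩ := exists_clm_integral_smul hT.le 2 2 hψ
  have hF := hasFDerivAt_feasibleMap hN hB hT x₀ x₁ u hP hD
  have hex : ∃ D, IsDifferential (feasibleMap N B t₀ T T x₀ x₁) u D := by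
    refine ⟨D₂, hF.differentiableAt, fun v w hw => ?_⟩
    rw [hF.fderiv, hD, hD₂]
    refine intervalIntegral.integral_congr_ae ?_
    filter_upwards [ae_timeMeasure_iff.1 hw] with q hq hqI
    rw [uIoc_of_le hT.le] at hqI
    rw [hq ⟨hqI.1.le, hqI.2⟩]
  -- Whichever extension was chosen, its value on the class of a bounded function is prescribed, so
  -- uniqueness of the extension is not needed.
  rw [differential, dif_pos hex, hex.choose_spec.2 v w hw, hF.fderiv, hD]

end

/-! ### Switching functions under the bracket condition -/

theorem IsResolvent.hasDerivWithinAt {A P : ℝ → Plane →L[ℝ] Plane} {s T t : ℝ}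
    (hP : IsResolvent A s T P) (hA : ContinuousOn A (Icc s T)) (ht : t ∈ Icc s T) :
    HasDerivWithinAt P (-(P t).comp (A t)) (Icc s T) t := by
  have hs : s ∈ Icc s T := left_mem_Icc.2 (ht.1.trans ht.2)
  have hc := hP.continuousOn.clm_comp hA
  have : Fact (t ∈ Icc s T) := ⟨ht⟩
  have hd := intervalIntegral.integral_hasDerivWithinAt_right (hP.intervalIntegrable hA hs ht)
    (s := Icc s T) (t := Icc s T)
    ⟨Icc s T, self_mem_nhdsWithin, hc.aestronglyMeasurable measurableSet_Icc⟩ (hc t ht)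
  refine (hd.const_sub (P s)).congr_of_mem (fun t' ht' => ?_) ht
  have := hP.sub_eq hA hs ht'
  rw [sub_eq_iff_eq_add] at this
  rw [this]
  abel

theorem InputAssumption.norm_sub_le {t₀ T b₀ b₁ b₂ : ℝ} {B : ℝ → Plane}
    (hB : InputAssumption t₀ T b₀ b₁ b₂ B) {s t : ℝ} (hs : s ∈ Icc t₀ T) (ht : t ∈ Icc t₀ T) :
    ‖B t - B s‖ ≤ b₁ * |t - s| :=
  (convex_Icc t₀ T).norm_image_sub_le_of_norm_derivWithin_le hB.differentiableOn
    hB.bound_deriv hs ht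

/-- Under the bracket condition, the switching functions are uniformly bounded below in `L²`. -/
theorem exists_mul_sq_le_integral_sq {t₀ T ν Λ₁ Λ₂ Λ₃ b₀ b₁ b₂ β r U : ℝ} (hT : t₀ < T)
    (hν : 0 ≤ ν) (hΛ₁ : 0 ≤ Λ₁) (hΛ₂ : 0 ≤ Λ₂) (hΛ₃ : 0 ≤ Λ₃) (hb₀ : 0 ≤ b₀) (hb₁ : 0 ≤ b₁)
    (hb₂ : 0 ≤ b₂) (hβ : 0 < β) (hr : 0 ≤ r) (hU : 0 ≤ U) :
    ∃ α : ℝ, 0 < α ∧ ∀ (N : ℝ → Plane → Plane) (B : ℝ → Plane),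
      DriftAssumption t₀ T ν Λ₁ Λ₂ Λ₃ N → InputAssumption t₀ T b₀ b₁ b₂ B →
      BracketCondition N B t₀ T β → ∀ x₀ : Plane, ‖x₀‖ ≤ r →
      ∀ u : Control t₀ T, ‖u‖ ≤ U → ∀ P : ℝ → Plane →L[ℝ] Plane,
        IsResolvent (fun q => fderiv ℝ (N q) (trajectory N B t₀ T x₀ u q)) t₀ T P →
        ∀ L : Plane →L[ℝ] ℝ, α * ‖L‖ ^ 2 ≤ ∫ t in t₀..T, L (P t (B t)) ^ 2 := by
  have hTt : 0 ≤ T - t₀ := by linarith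
  -- `E` bounds the resolvent, `R` the trajectory and `W` the bracket vector `w`; `S` and `G` bound
  -- the rates of change of the trajectory and of `w`. The added `1` in `C` and in `c` guards
  -- against vanishing data.
  set E := Real.exp (Λ₁ * (T - t₀)) with hE
  have hE0 : 0 < E := Real.exp_pos _
  set R := (r + (ν + U * b₀) * (T - t₀)) * E with hR
  set S := Λ₁ * R + ν + U * b₀ with hS
  have hR0 : 0 ≤ R := by positivity
  have hS0 : 0 ≤ S := by positivity
  set W := Λ₁ * b₀ + b₁ with hW
  have hW0 : 0 ≤ W := by positivity
  set G := (Λ₃ + Λ₂ * S) * b₀ + Λ₁ * b₁ + b₂ with hG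
  have hG0 : 0 ≤ G := by positivity
  set C := E * W + (E * Λ₁ * W + E * G) + 1 with hC
  have hC0 : 0 < C := by positivity
  set c := β / (2 * (b₀ + W + 1) * E) with hc
  have hc0 : 0 < c := by positivity
  obtain ⟨α, hα, hαint⟩ := exists_le_integral_sq hT hc0 hC0
  refine ⟨α, hα, fun N B hN hB hbr x₀ hx₀ u hu P hP L => ?_⟩
  -- Both sides are quadratic in `L`.
  wlog hL1 : ‖L‖ = 1 generalizing L
  · rcases eq_or_ne L 0 with rfl | hL
    · simp
    have hLn : ‖L‖ ≠ 0 := norm_ne_zero_iff.2 hL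
    have h1 : ‖(‖L‖⁻¹ • L)‖ = 1 := by
      rw [norm_smul, norm_inv, norm_norm, inv_mul_cancel₀ hLn]
    have h := this (‖L‖⁻¹ • L) h1
    simp only [smul_apply, smul_eq_mul, mul_pow, h1, one_pow, mul_one,
      intervalIntegral.integral_const_mul] at h
    have h2 := mul_le_mul_of_nonneg_right h (sq_nonneg ‖L‖)
    refine h2.trans (le_of_eq ?_)
    field_simp
  set X := trajectory N B t₀ T x₀ u with hXdef
  set A : ℝ → Plane →L[ℝ] Plane := fun q => fderiv ℝ (N q) (X q) with hA
  set w : ℝ → Plane := fun t => A t (B t) - inputDeriv B t₀ T t with hw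
  have hX := isSolution_trajectory hN hB hT.le x₀ u
  have hI₀ : t₀ ∈ Icc t₀ T := left_mem_Icc.2 hT.le
  have cX := hX.continuousOn
  rw [uIcc_of_le hT.le] at cX
  have cA : ContinuousOn A (Icc t₀ T) := hN.continuousOn_fderiv le_rfl cX
  have bA : ∀ t ∈ Icc t₀ T, ‖A t‖ ≤ Λ₁ := fun t ht => hN.bound_fderiv t ht _
  have hg : ∀ᵐ q, q ∈ Icc t₀ T → ‖u q • B q‖ ≤ U * b₀ := by
    filter_upwards [hB.ae_norm_smul_le u] with q hq hqI
    exact (hq hqI).trans (by gcongr)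
  have hXR : ∀ t ∈ Icc t₀ T, ‖X t‖ ≤ R := by
    intro t ht
    refine (hN.norm_solution_le hI₀ hX hν (by positivity) hg ht).trans ?_
    rw [hR]
    gcongr
  have hXL : ∀ t ∈ Icc t₀ T, ‖X t - X t₀‖ ≤ S * (t - t₀) := by
    intro t ht
    have := hN.norm_solution_sub_le_mul_abs hI₀ hX hXR hg hI₀ ht
    rwa [abs_of_nonneg (sub_nonneg.2 ht.1)] at this
  have hPE : ∀ t ∈ Icc t₀ T, ‖P t‖ ≤ E := fun t ht => hP.norm_le' hΛ₁ bA ht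
  have hPL : ∀ t ∈ Icc t₀ T, ‖P t - P t₀‖ ≤ E * Λ₁ * (t - t₀) := by
    intro t ht
    have := hP.norm_sub_le_mul_abs cA hΛ₁ bA hI₀ ht
    rwa [abs_of_nonneg (sub_nonneg.2 ht.1)] at this
  have hwW : ∀ t ∈ Icc t₀ T, ‖w t‖ ≤ W := by
    intro t ht
    refine (_root_.norm_sub_le _ _).trans (add_le_add ?_ (hB.bound_deriv t ht))
    exact ((A t).le_opNorm _).trans (mul_le_mul (bA t ht) (hB.bound t ht) (norm_nonneg _) hΛ₁)
  have hwL : ∀ t ∈ Icc t₀ T, ‖w t - w t₀‖ ≤ G * (t - t₀) := by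
    intro t ht
    have htt : 0 ≤ t - t₀ := sub_nonneg.2 ht.1
    have h1 := hN.norm_fderiv_sub_le' hI₀ ht (X t) (X t₀)
    have h2 := hB.norm_sub_le hI₀ ht
    have h3 := hB.lipschitz_deriv t₀ hI₀ t ht
    rw [abs_of_nonneg htt] at h1 h2 h3
    have e : w t - w t₀ = (A t - A t₀) (B t) + A t₀ (B t - B t₀)
        - (inputDeriv B t₀ T t - inputDeriv B t₀ T t₀) := by
      simp only [hw, sub_apply, map_sub]; abel
    rw [e]
    have h4 : ‖(A t - A t₀) (B t)‖ ≤ (Λ₃ * (t - t₀) + Λ₂ * (S * (t - t₀))) * b₀ := by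
      refine (ContinuousLinearMap.le_opNorm _ _).trans
        (mul_le_mul (h1.trans ?_) (hB.bound t ht) (norm_nonneg _) (by positivity))
      gcongr
      exact hXL t ht
    have h5 : ‖A t₀ (B t - B t₀)‖ ≤ Λ₁ * (b₁ * (t - t₀)) :=
      (ContinuousLinearMap.le_opNorm _ _).trans
        (mul_le_mul (bA t₀ hI₀) h2 (norm_nonneg _) hΛ₁)
    refine (_root_.norm_sub_le _ _).trans
      ((add_le_add ((norm_add_le _ _).trans (add_le_add h4 h5)) h3).trans (le_of_eq ?_))
    rw [hG]; ring
  have hLle : ∀ x : Plane, |L x| ≤ ‖x‖ := fun x => by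
    simpa [hL1] using L.le_opNorm x
  rw [hL1, one_pow, mul_one]
  -- Since `P' = -P A`, the derivative of `P B` is `-P (A B - B') = -P w`, which does not involve
  -- `u` directly.
  refine hαint (fun t => L (P t (B t))) (fun t => -L (P t (w t))) ?_ ?_ ?_ ?_
  · intro t ht
    have h1 := (hP.hasDerivWithinAt cA ht).clm_apply
      ((hB.differentiableOn t ht).hasDerivWithinAt)
    have h2 := (L.hasFDerivAt (x := P t (B t))).comp_hasDerivWithinAt t h1
    have e : -L (P t (w t))
        = L ((-(P t).comp (A t)) (B t) + P t (derivWithin B (Icc t₀ T) t)) := by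
      simp only [hw, inputDeriv, map_sub, map_add, neg_apply, ContinuousLinearMap.comp_apply,
        map_neg]
      ring
    rw [e]
    exact h2
  · intro t ht
    rw [abs_neg]
    have h1 : ‖P t (w t)‖ ≤ E * W := ((P t).le_opNorm _).trans
      (mul_le_mul (hPE t ht) (hwW t ht) (norm_nonneg _) hE0.le)
    have h2 : 0 ≤ E * Λ₁ * W + E * G := by positivity
    linarith [hLle (P t (w t))]
  · intro t ht
    have htt : 0 ≤ t - t₀ := sub_nonneg.2 ht.1
    have e : -L (P t (w t)) - -L (P t₀ (w t₀))
        = -L ((P t - P t₀) (w t) + P t₀ (w t - w t₀)) := by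
      simp only [map_add, map_sub, sub_apply]; ring
    rw [e, abs_neg]
    have h1 : ‖(P t - P t₀) (w t)‖ ≤ (E * Λ₁ * (t - t₀)) * W :=
      (ContinuousLinearMap.le_opNorm _ _).trans
        (mul_le_mul (hPL t ht) (hwW t ht) (norm_nonneg _) (by positivity))
    have h2 : ‖P t₀ (w t - w t₀)‖ ≤ E * (G * (t - t₀)) :=
      (ContinuousLinearMap.le_opNorm _ _).trans
        (mul_le_mul (hPE t₀ hI₀) (hwL t ht) (norm_nonneg _) hE0.le)
    have h3 : 0 ≤ (E * W + 1) * (t - t₀) := by positivity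
    refine (hLle _).trans ((norm_add_le _ _).trans ((add_le_add h1 h2).trans ?_))
    rw [hC]
    linarith
  -- The functional `L ∘ P t₀` has norm at least `1 / E`, and the bracket condition at `(t₀,
  -- x_u(t₀))` prevents it from being small on both `B t₀` and `w t₀`.
  · have h1 := norm_mul_abs_det₂_le (L.comp (P t₀)) (B t₀) (w t₀)
    have h2 := hP.norm_le_norm_comp cA hΛ₁ bA hT.le L
    rw [hL1, ← hE] at h2
    have h3 : β ≤ |det₂ (B t₀) (w t₀)| := hbr t₀ hI₀ (X t₀)
    rw [abs_neg, hc, div_le_iff₀ (by positivity)]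
    set ℓ := ‖L.comp (P t₀)‖ with hℓ
    set V := |L (P t₀ (B t₀))| + |L (P t₀ (w t₀))| with hV
    have hV0 : 0 ≤ V := by positivity
    have hℓ0 : 0 ≤ ℓ := norm_nonneg _
    calc β ≤ (ℓ * E) * β := le_mul_of_one_le_left hβ.le h2
      _ = (ℓ * β) * E := by ring
      _ ≤ (ℓ * |det₂ (B t₀) (w t₀)|) * E := by gcongr
      _ ≤ (2 * (‖B t₀‖ + ‖w t₀‖) * V) * E := mul_le_mul_of_nonneg_right h1 hE0.le
      _ ≤ (2 * (b₀ + W + 1) * V) * E := by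
          have h4 : ‖B t₀‖ + ‖w t₀‖ ≤ b₀ + W + 1 := by
            linarith [hB.bound t₀ hI₀, hwW t₀ hI₀]
          gcongr
      _ = V * (2 * (b₀ + W + 1) * E) := by ring

/-! ### From switching functions to the Gramian -/

/-- `α` has to be fixed before `N` and `B` are given, when the signs of the constants are not yet
known; absolute values supply the nonnegativity. -/
theorem DriftAssumption.abs {t₀ T ν Λ₁ Λ₂ Λ₃ : ℝ} {N : ℝ → Plane → Plane}
    (hN : DriftAssumption t₀ T ν Λ₁ Λ₂ Λ₃ N) : DriftAssumption t₀ T |ν| |Λ₁| |Λ₂| |Λ₃| N where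
  memLp := hN.memLp
  bound_zero := hN.bound_zero.mono fun _ h => h.trans (le_abs_self _)
  contDiff := hN.contDiff
  bound_fderiv t ht x := (hN.bound_fderiv t ht x).trans (le_abs_self _)
  bound_fderiv_two t ht x := (hN.bound_fderiv_two t ht x).trans (le_abs_self _)
  lipschitz_fderiv x s hs t ht := (hN.lipschitz_fderiv x s hs t ht).trans
    (mul_le_mul_of_nonneg_right (le_abs_self _) (abs_nonneg _))

theorem InputAssumption.abs {t₀ T b₀ b₁ b₂ : ℝ} {B : ℝ → Plane}
    (hB : InputAssumption t₀ T b₀ b₁ b₂ B) : InputAssumption t₀ T |b₀| |b₁| |b₂| B where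
  differentiableOn := hB.differentiableOn
  bound t ht := (hB.bound t ht).trans (le_abs_self _)
  bound_deriv t ht := (hB.bound_deriv t ht).trans (le_abs_self _)
  lipschitz_deriv s hs t ht := (hB.lipschitz_deriv s hs t ht).trans
    (mul_le_mul_of_nonneg_right (le_abs_self _) (abs_nonneg _))

/-- The empirical Gramian dominates the `L²` norm of the switching functions. -/
theorem integral_sq_le_norm_adjoint_sq {t₀ T ν Λ₁ Λ₂ Λ₃ b₀ b₁ b₂ : ℝ} {N : ℝ → Plane → Plane}
    {B : ℝ → Plane} (hN : DriftAssumption t₀ T ν Λ₁ Λ₂ Λ₃ N)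
    (hB : InputAssumption t₀ T b₀ b₁ b₂ B) (hT : t₀ < T) (x₀ x₁ : Plane) (u : Control t₀ T)
    {P : ℝ → Plane →L[ℝ] Plane}
    (hP : IsResolvent (fun q => fderiv ℝ (N q) (trajectory N B t₀ T x₀ u q)) t₀ T P)
    (ζ : Plane) :
    ∫ t in t₀..T, (innerSL ℝ ζ) (P t (B t)) ^ 2 ≤
      ‖ContinuousLinearMap.adjoint (differential (feasibleMap N B t₀ T T x₀ x₁) u) ζ‖ ^ 2 := by
  set D := differential (feasibleMap N B t₀ T T x₀ x₁) u with hD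
  have hψ : ContinuousOn (fun t => P t (B t)) (Icc t₀ T) :=
    hP.continuousOn.clm_apply hB.continuousOn
  set φ : ℝ → ℝ := fun t => (innerSL ℝ ζ) (P t (B t)) with hφ
  have cφ : ContinuousOn φ (Icc t₀ T) := (innerSL ℝ ζ).continuous.comp_continuousOn hψ
  have hmem : ∀ p : ℝ≥0∞, MemLp φ p (timeMeasure t₀ T) := by
    intro p
    obtain ⟨C, hC⟩ := isCompact_Icc.exists_bound_of_continuousOn cφ
    refine MemLp.of_bound ?_ C (ae_timeMeasure_iff.2 (ae_of_all _ hC))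
    rw [timeMeasure_eq]
    exact cφ.aestronglyMeasurable measurableSet_Icc
  -- The bounded function `φ` is itself an admissible direction. With `w` its `L²` class, `⟨ζ, D w⟩
  -- = ∫ φ² = ‖w‖²`, and Cauchy–Schwarz gives `‖w‖ ≤ ‖D* ζ‖` without computing the adjoint.
  set v : Control t₀ T := (hmem ∞).toLp with hv
  set w : ControlL2 t₀ T := (hmem 2).toLp with hw
  have hvφ : v =ᵐ[timeMeasure t₀ T] φ := (hmem ∞).coeFn_toLp
  have hwφ : w =ᵐ[timeMeasure t₀ T] φ := (hmem 2).coeFn_toLp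
  have hDw := isDifferential_differential hN hB hT x₀ x₁ u hP v w (hwφ.trans hvφ.symm)
  rw [← hD] at hDw
  set I := ∫ t in t₀..T, φ t ^ 2 with hI
  have h1 : inner ℝ ζ (D w) = I := by
    rw [hDw, ← innerSL_apply_apply ℝ, ← (innerSL ℝ ζ).intervalIntegral_comp_comm
      (intervalIntegrable_control_smul hψ hT.le v)]
    refine intervalIntegral.integral_congr_ae ?_
    filter_upwards [ae_timeMeasure_iff.1 hvφ] with q hq hqI
    rw [uIoc_of_le hT.le] at hqI
    rw [hq ⟨hqI.1.le, hqI.2⟩, map_smul, smul_eq_mul, sq]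
  have h2 : ‖w‖ ^ 2 = I := by
    rw [← real_inner_self_eq_norm_sq, L2.inner_def, hI, intervalIntegral.integral_of_le hT.le,
      ← integral_Icc_eq_integral_Ioc, ← timeMeasure_eq]
    refine integral_congr_ae ?_
    filter_upwards [hwφ] with q hq
    rw [hq, real_inner_self_eq_norm_sq, Real.norm_eq_abs, sq_abs]
  have h3 : I ≤ ‖ContinuousLinearMap.adjoint D ζ‖ * ‖w‖ := by
    rw [← h1, ← ContinuousLinearMap.adjoint_inner_left]
    exact real_inner_le_norm _ _
  rw [← h2] at h3 ⊢
  rcases (norm_nonneg w).eq_or_lt with h0 | h0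
  · rw [← h0, zero_pow two_ne_zero]; positivity
  · rw [sq] at h3
    exact pow_le_pow_left₀ h0.le (le_of_mul_le_mul_right h3 h0) 2

end PlanarControl

theorem mainTheorem5 (t₀ T : ℝ) (ht₀ : 0 ≤ t₀) (hT : t₀ < T)
    (ν Λ₁ Λ₂ Λ₃ b₀ b₁ b₂ : ℝ) (β r U : ℝ) (hβ : 0 < β) (hU : 0 < U) :
    ∃ α : ℝ, 0 < α ∧
      ∀ (N : ℝ → PlanarControl.Plane → PlanarControl.Plane) (B : ℝ → PlanarControl.Plane),
        PlanarControl.DriftAssumption t₀ T ν Λ₁ Λ₂ Λ₃ N →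
        PlanarControl.InputAssumption t₀ T b₀ b₁ b₂ B →
        PlanarControl.BracketCondition N B t₀ T β →
        ∀ x0 x1 : PlanarControl.Plane, ‖x0‖ = r →
        ∀ u : PlanarControl.Control t₀ T, ‖u‖ ≤ U →
          α • ContinuousLinearMap.id ℝ PlanarControl.Plane ≤
            PlanarControl.empiricalGramian N B t₀ T T x0 x1 u := by
  obtain ⟨α, hα, h⟩ := PlanarControl.exists_mul_sq_le_integral_sq hT (abs_nonneg ν)
    (abs_nonneg Λ₁) (abs_nonneg Λ₂) (abs_nonneg Λ₃) (abs_nonneg b₀) (abs_nonneg b₁)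
    (abs_nonneg b₂) hβ (abs_nonneg r) hU.le
  refine ⟨α, hα, fun N B hN hB hbr x0 x1 hx0 u hu => ?_⟩
  have hX := (PlanarControl.isSolution_trajectory hN hB hT.le x0 u).continuousOn
  rw [uIcc_of_le hT.le] at hX
  obtain ⟨P, hP⟩ := hN.exists_isResolvent (left_mem_Icc.2 hT.le) hX
  rw [ContinuousLinearMap.le_def]
  have hpos := ContinuousLinearMap.isPositive_self_comp_adjoint
    (PlanarControl.differential (PlanarControl.feasibleMap N B t₀ T T x0 x1) u)
  -- The Loewner order asks for symmetry and for `α ‖ζ‖² ≤ ⟨M ζ, ζ⟩ = ‖D* ζ‖²`.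
  refine ⟨hpos.isSymmetric.sub ?_, fun ζ => ?_⟩
  · intro x y
    simp [inner_smul_left, inner_smul_right]
  · have h1 := h N B hN.abs hB.abs hbr x0 (hx0.le.trans (le_abs_self r)) u hu P hP
      (innerSL ℝ ζ)
    have h2 := PlanarControl.integral_sq_le_norm_adjoint_sq hN hB hT x0 x1 u hP ζ
    rw [innerSL_apply_norm] at h1
    have h3 := h1.trans h2
    rw [ContinuousLinearMap.reApplyInnerSelf_apply, PlanarControl.empiricalGramian]
    simp only [sub_apply, smul_apply, ContinuousLinearMap.id_apply,
      ContinuousLinearMap.comp_apply, inner_sub_left, inner_smul_left, RCLike.re_to_real,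
      real_inner_self_eq_norm_sq]
    rw [← ContinuousLinearMap.adjoint_inner_right, real_inner_self_eq_norm_sq]
    simpa using h3
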